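/- **Proposition 2.4.** Let $\Xi$ be a Hausdorff, locally compact, $\sigma$-compact topological groupoid with unit space $X$, source map $\mathrm d$ and range map $\mathrm r$ (all structure maps being continuous). Let $\lambda=\{\lambda_x\mid x\in X\}$ be a right Haar system on $\Xi$: each $\lambda_x$ is a regular Borel measure with full support on the fibre $\Xi_x=\mathrm d^{-1}(\{x\})$, the map $x\mapsto\int_{\Xi_x} f\,d\lambda_x$ is continuous for every $f\in C_c(\Xi)$, and for each $\xi\in\Xi$ the homeomorphism $\Xi_{\mathrm r(\xi)}\ni\eta\mapsto\eta\xi\in\Xi_{\mathrm d(\xi)}$ transports $\lambda_{\mathrm r(\xi)}$ to $\lambda_{\mathrm d(\xi)}$. Let $\omega:\Xi^{(2)}\to\mathbb T$ be a continuous $2$-cocycle on the set of composable pairs, that is, $\omega(\xi,\eta)\,\omega(\xi\eta,\zeta)=\omega(\eta,\zeta)\,\omega(\xi,\eta\zeta)$ whenever these products are defined, normalized by $\omega(x,\eta)=1=\omega(\xi,x)$ for units $x=\mathrm r(\eta)=\mathrm d(\xi)$. Endow $C_c(\Xi)$ with the product and involution $$(f\star_\omega g)(\xi)=\int_{\Xi_{\mathrm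 d(\xi)}} f(\xi\eta^{-1})\,g(\eta)\,\omega(\xi\eta^{-1},\eta)\,d\lambda_{\mathrm d(\xi)}(\eta),\qquad f^{\star_\omega}(\xi)=\overline{\omega(\xi,\xi^{-1})}\;\overline{f(\xi^{-1})}.$$ For $x\in X$ put $\mathcal H_x=L^2(\Xi_x;\lambda_x)$ and let $\Pi_x(f)u=f\star_\omega u$ for $f\in C_c(\Xi)$, $u\in\mathcal H_x$. Let $\mathsf C^*_{\mathrm r}(\Xi,\omega)$ be the completion of $C_c(\Xi)$ in the reduced norm $\|f\|=\sup_{x\in X}\|\Pi_x(f)\|_{\mathbb B(\mathcal H_x)}$; each $\Pi_x$ extends by continuity to a $*$-representation $\Pi_x:\mathsf C^*_{\mathrm r}(\Xi,\omega)\to\mathbb B(\mathcal H_x)$. Assume that $M\subset X$ is an orbit (a set of the form $\mathrm r(\Xi_z)$ with $z\in X$) that is dense in $X$. Then for every $x\in M$: 1. the representation $\Pi_x$ of $\mathsf C^*_{\mathrm r}(\Xi,\omega)$ is faithful (injective); 2. $\Pi_x$ has exactly one extension to a unital $*$-homomorphism $\Pi_x^{\mathbf M}$ from the multiplier algebra of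 $\mathsf C^*_{\mathrm r}(\Xi,\omega)$ to $\mathbb B(\mathcal H_x)$, and $\Pi_x^{\mathbf M}$ is faithful as well. -/

import Mathlib

open CategoryTheory MeasureTheory Topology Filter
open scoped CompactlySupported ENNReal NNReal

namespace TwistedGroupoid

set_option linter.unusedSectionVars false
set_option linter.unusedVariables false

universe v u

/-- The set `Ξ` of all arrows of a groupoid with set of units (objects) `X`. -/
structure Arr (X : Type u) [Groupoid.{v} X] where
  /-- the source (domain) `d(ξ)` -/
  src : X
  /-- the range `r(ξ)` -/
  tgt : X
  /-- the arrow itself -/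
  hom : src ⟶ tgt

/-- The set `Ξ⁽²⁾` of composable pairs `(ξ, η)`, `d(ξ) = r(η)`, where `ξ = left`, `η = right`.
The groupoid product `ξη` (first `η`, then `ξ`) is `right ≫ left` in categorical notation. -/
structure Comp (X : Type u) [Groupoid.{v} X] where
  src : X
  mid : X
  tgt : X
  left : mid ⟶ tgt
  right : src ⟶ mid

/-- The fibre `Ξ_x = {ξ ∈ Ξ | d(ξ) = x}`. -/
structure Fibre {X : Type u} [Groupoid.{v} X] (x : X) where
  tgt : X
  hom : x ⟶ tgt

section Basic

variable {X : Type u} [Groupoid.{v} X]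

/-- The unit arrow at `x`. -/
def Arr.unit (x : X) : Arr X := ⟨x, x, 𝟙 x⟩

/-- The inverse arrow `ξ⁻¹`. -/
def Arr.inv (ξ : Arr X) : Arr X := ⟨ξ.tgt, ξ.src, Groupoid.inv ξ.hom⟩

/-- The first member `ξ` of a composable pair `(ξ, η)`. -/
def Comp.fst (p : Comp X) : Arr X := ⟨p.mid, p.tgt, p.left⟩

/-- The second member `η` of a composable pair `(ξ, η)`. -/
def Comp.snd (p : Comp X) : Arr X := ⟨p.src, p.mid, p.right⟩

/-- The product `ξη` of a composable pair `(ξ, η)`. -/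
def Comp.mul (p : Comp X) : Arr X := ⟨p.src, p.tgt, p.right ≫ p.left⟩

/-- The inclusion `Ξ_x ⊆ Ξ`. -/
def Fibre.toArr {x : X} (ξ : Fibre x) : Arr X := ⟨x, ξ.tgt, ξ.hom⟩

/-- For an arrow `η` and `ξ ∈ Ξ_{d(η)}`, the arrow `ξη⁻¹`. -/
def Fibre.mulInv {x : X} (ξ η : Fibre x) : Arr X :=
  ⟨η.tgt, ξ.tgt, Groupoid.inv η.hom ≫ ξ.hom⟩

/-- Right translation `Ξ_{r(ξ)} → Ξ_{d(ξ)}`, `η ↦ ηξ`. -/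
def Fibre.rightMul {x y : X} (ξ : x ⟶ y) (η : Fibre y) : Fibre x := ⟨η.tgt, ξ ≫ η.hom⟩

/-- The arrow `ξ`, seen as an element of its fibre. -/
def Arr.toFibre (ξ : Arr X) : Fibre ξ.src := ⟨ξ.tgt, ξ.hom⟩

/-- The orbit `𝒪_x = r(Ξ_x)` of the unit `x`. -/
def orbit (x : X) : Set X := {y | Nonempty (x ⟶ y)}

/-- `Ξ⁽²⁾` has the topology of a subspace of `Ξ × Ξ`. -/
instance [TopologicalSpace (Arr X)] : TopologicalSpace (Comp X) :=
  TopologicalSpace.induced (fun p => (p.fst, p.snd)) inferInstance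

/-- `Ξ_x` has the topology of a subspace of `Ξ`. -/
instance [TopologicalSpace (Arr X)] (x : X) : TopologicalSpace (Fibre x) :=
  TopologicalSpace.induced Fibre.toArr inferInstance

instance [TopologicalSpace (Arr X)] (x : X) : MeasurableSpace (Fibre x) := borel _

instance [TopologicalSpace (Arr X)] (x : X) : BorelSpace (Fibre x) := ⟨rfl⟩

end Basic

/-- A topological groupoid: all structure maps are continuous. (As `d ∘ unit` is the identity of
`X`, the given topology of `X` is the one that `X` has as the subspace of units of `Ξ`.) -/
class TopGroupoid (X : Type u) [Groupoid.{v} X] [TopologicalSpace X]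
    [TopologicalSpace (Arr X)] : Prop where
  continuous_src : Continuous (Arr.src : Arr X → X)
  continuous_tgt : Continuous (Arr.tgt : Arr X → X)
  continuous_unit : Continuous (Arr.unit : X → Arr X)
  continuous_inv : Continuous (Arr.inv : Arr X → Arr X)
  continuous_mul : Continuous (Comp.mul : Comp X → Arr X)

/-- A right Haar system: regular (Radon) Borel measures `λ_x` on the fibres `Ξ_x`, of full support,
such that `x ↦ ∫ f dλ_x` is continuous for every `f ∈ C_c(Ξ)`, and such that the right translation
`Ξ_{r(ξ)} → Ξ_{d(ξ)}`, `η ↦ ηξ`, transports `λ_{r(ξ)}` to `λ_{d(ξ)}`. -/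
structure HaarSystem (X : Type u) [Groupoid.{v} X] [TopologicalSpace X]
    [TopologicalSpace (Arr X)] where
  /-- the measure `λ_x` on the fibre `Ξ_x` -/
  meas (x : X) : Measure (Fibre x)
  regular (x : X) : (meas x).Regular
  fullSupport (x : X) : (meas x).IsOpenPosMeasure
  continuous_integral (f : C_c(Arr X, ℂ)) :
    Continuous fun x => ∫ η : Fibre x, f η.toArr ∂(meas x)
  map_rightMul {x y : X} (ξ : x ⟶ y) : (meas y).map (Fibre.rightMul ξ) = meas x

/-- A continuous normalized `2`-cocycle `ω : Ξ⁽²⁾ → 𝕋`, written `ω.app ξ η` for `(ξ, η) ∈ Ξ⁽²⁾`. -/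
structure TwoCocycle (X : Type u) [Groupoid.{v} X] [TopologicalSpace (Arr X)] where
  app {x y z : X} (ξ : y ⟶ z) (η : x ⟶ y) : Circle
  continuous_app : Continuous fun p : Comp X => app p.left p.right
  cocycle {w x y z : X} (ξ : y ⟶ z) (η : x ⟶ y) (ζ : w ⟶ x) :
    app ξ η * app (η ≫ ξ) ζ = app η ζ * app ξ (ζ ≫ η)
  unit_left {x y : X} (η : x ⟶ y) : app (𝟙 y) η = 1
  unit_right {x y : X} (ξ : x ⟶ y) : app ξ (𝟙 x) = 1

section Topology

variable {X : Type u} [Groupoid.{v} X] [TopologicalSpace X] [TopologicalSpace (Arr X)]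
  [TopGroupoid X]

theorem t2Space_units [T2Space (Arr X)] : T2Space X :=
  T2Space.of_injective_continuous (f := (Arr.unit : X → Arr X))
    (fun x y h => congrArg Arr.src h) TopGroupoid.continuous_unit

theorem Fibre.toArr_injective {x : X} : Function.Injective (Fibre.toArr : Fibre x → Arr X) := by
  rintro ⟨a, f⟩ ⟨b, g⟩ h
  simp only [Fibre.toArr, Arr.mk.injEq, true_and] at h
  obtain ⟨rfl, h⟩ := h
  simp_all

theorem Comp.pair_injective :
    Function.Injective (fun p : Comp X => (p.fst, p.snd)) := by
  rintro ⟨a, b, c, f, g⟩ ⟨a', b', c', f', g'⟩ h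
  simp only [Comp.fst, Comp.snd, Prod.mk.injEq, Arr.mk.injEq] at h
  obtain ⟨⟨rfl, rfl, h1⟩, rfl, -, h2⟩ := h
  simp_all

theorem Fibre.isClosedEmbedding_toArr [T2Space (Arr X)] (x : X) :
    IsClosedEmbedding (Fibre.toArr : Fibre x → Arr X) := by
  have := t2Space_units (X := X)
  refine ⟨⟨⟨rfl⟩, Fibre.toArr_injective⟩, ?_⟩
  have : Set.range (Fibre.toArr : Fibre x → Arr X) = {ξ | ξ.src = x} := by
    ext ξ
    constructor
    · rintro ⟨η, rfl⟩; rfl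
    · rintro rfl; exact ⟨ξ.toFibre, rfl⟩
  rw [this]
  exact isClosed_eq TopGroupoid.continuous_src continuous_const

theorem Comp.isClosedEmbedding_pair [T2Space (Arr X)] :
    IsClosedEmbedding (fun p : Comp X => (p.fst, p.snd)) := by
  have := t2Space_units (X := X)
  refine ⟨⟨⟨rfl⟩, Comp.pair_injective⟩, ?_⟩
  have : Set.range (fun p : Comp X => (p.fst, p.snd)) = {p : Arr X × Arr X | p.1.src = p.2.tgt} := by
    ext ⟨⟨a, b, f⟩, ⟨a', b', g⟩⟩
    constructor
    · rintro ⟨η, h⟩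
      rw [← h]; rfl
    · rintro h
      simp only [Set.mem_ofPred_eq] at h
      subst h
      exact ⟨⟨a', a, b, f, g⟩, rfl⟩
  rw [this]
  exact isClosed_eq (TopGroupoid.continuous_src.comp continuous_fst)
    (TopGroupoid.continuous_tgt.comp continuous_snd)

theorem Comp.continuous_iff {Y : Type*} [TopologicalSpace Y] {f : Y → Comp X} :
    Continuous f ↔ Continuous (fun y => (f y).fst) ∧ Continuous (fun y => (f y).snd) := by
  rw [continuous_induced_rng, ← continuous_prodMk]
  rfl

theorem Fibre.continuous_toArr (x : X) : Continuous (Fibre.toArr : Fibre x → Arr X) :=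
  continuous_induced_dom

theorem Fibre.continuous_mulInv (x : X) :
    Continuous (fun p : Fibre x × Fibre x => p.1.mulInv p.2) := by
  have h : Continuous (fun p : Fibre x × Fibre x =>
      (⟨p.2.tgt, x, p.1.tgt, p.1.hom, Groupoid.inv p.2.hom⟩ : Comp X)) := by
    rw [Comp.continuous_iff]
    exact ⟨(Fibre.continuous_toArr x).comp continuous_fst,
      TopGroupoid.continuous_inv.comp ((Fibre.continuous_toArr x).comp continuous_snd)⟩
  exact TopGroupoid.continuous_mul.comp h

theorem Fibre.continuous_rightMul {x y : X} (ξ : x ⟶ y) :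
    Continuous (Fibre.rightMul ξ : Fibre y → Fibre x) := by
  rw [continuous_induced_rng]
  have h : Continuous (fun η : Fibre y => (⟨x, y, η.tgt, η.hom, ξ⟩ : Comp X)) := by
    rw [Comp.continuous_iff]
    exact ⟨Fibre.continuous_toArr y, continuous_const (y := (⟨x, y, ξ⟩ : Arr X))⟩
  exact TopGroupoid.continuous_mul.comp h

/-- Pairs of arrows with the same source. -/
structure Par (X : Type u) [Groupoid.{v} X] where
  src : X
  fst : Fibre src
  snd : Fibre src

instance : TopologicalSpace (Par X) :=
  TopologicalSpace.induced (fun p => (p.fst.toArr, p.snd.toArr)) inferInstance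

theorem Par.isClosedEmbedding_pair [T2Space (Arr X)] :
    IsClosedEmbedding (fun p : Par X => (p.fst.toArr, p.snd.toArr)) := by
  have := t2Space_units (X := X)
  refine ⟨⟨⟨rfl⟩, ?_⟩, ?_⟩
  · rintro ⟨a, f, g⟩ ⟨a', f', g'⟩ h
    obtain ⟨h1, h2⟩ := Prod.mk.inj h
    obtain rfl : a = a' := congrArg Arr.src h1
    obtain rfl : f = f' := Fibre.toArr_injective h1
    obtain rfl : g = g' := Fibre.toArr_injective h2
    rfl
  have : Set.range (fun p : Par X => (p.fst.toArr, p.snd.toArr)) =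
      {p : Arr X × Arr X | p.1.src = p.2.src} := by
    ext ⟨⟨a, b, f⟩, ⟨a', b', g⟩⟩
    constructor
    · rintro ⟨η, h⟩
      rw [← h]; rfl
    · rintro h
      simp only [Set.mem_ofPred_eq] at h
      subst h
      exact ⟨⟨a, ⟨b, f⟩, ⟨b', g⟩⟩, rfl⟩
  rw [this]
  exact isClosed_eq (TopGroupoid.continuous_src.comp continuous_fst)
    (TopGroupoid.continuous_src.comp continuous_snd)

/-- The composable pair `(ξη⁻¹, η)`. -/
def Par.toComp (p : Par X) : Comp X :=
  ⟨p.src, p.snd.tgt, p.fst.tgt, Groupoid.inv p.snd.hom ≫ p.fst.hom, p.snd.hom⟩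

theorem Par.continuous_fst : Continuous (fun p : Par X => p.fst.toArr) :=
  _root_.continuous_fst.comp
    (continuous_induced_dom (f := fun p : Par X => (p.fst.toArr, p.snd.toArr)))

theorem Par.continuous_snd : Continuous (fun p : Par X => p.snd.toArr) :=
  _root_.continuous_snd.comp
    (continuous_induced_dom (f := fun p : Par X => (p.fst.toArr, p.snd.toArr)))

theorem Par.continuous_toComp : Continuous (Par.toComp : Par X → Comp X) := by
  rw [Comp.continuous_iff]
  refine ⟨?_, Par.continuous_snd⟩
  have h : Continuous (fun p : Par X =>
      (⟨p.snd.tgt, p.src, p.fst.tgt, p.fst.hom, Groupoid.inv p.snd.hom⟩ : Comp X)) := by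
    rw [Comp.continuous_iff]
    exact ⟨Par.continuous_fst, TopGroupoid.continuous_inv.comp Par.continuous_snd⟩
  exact TopGroupoid.continuous_mul.comp h

theorem Par.continuous_of_fibre (x : X) :
    Continuous (fun p : Fibre x × Fibre x => (⟨x, p.1, p.2⟩ : Par X)) := by
  rw [continuous_induced_rng]
  exact ((Fibre.continuous_toArr x).comp _root_.continuous_fst).prodMk
    ((Fibre.continuous_toArr x).comp _root_.continuous_snd)

theorem Arr.isClosedEmbedding_inv : IsClosedEmbedding (Arr.inv : Arr X → Arr X) := by
  have h : Function.Involutive (Arr.inv : Arr X → Arr X) := by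
    rintro ⟨a, b, f⟩; simp [Arr.inv]
  exact (Homeomorph.mk h.toPerm TopGroupoid.continuous_inv TopGroupoid.continuous_inv
    ).isClosedEmbedding

end Topology
section Kernel

variable {F : Type*} [MeasurableSpace F]

/-- A measurable kernel satisfying the hypotheses of the Schur test with constant `C`. -/
structure IsSchurKernel (μ : Measure F) (k : F → F → ℂ) (C : ℝ≥0) : Prop where
  stronglyMeasurable : StronglyMeasurable (Function.uncurry k)
  row (ξ : F) : ∫⁻ η, ‖k ξ η‖ₑ ∂μ ≤ C
  col (η : F) : ∫⁻ ξ, ‖k ξ η‖ₑ ∂μ ≤ C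
  memLp (ξ : F) : MemLp (k ξ) 2 μ

variable {μ : Measure F} [SFinite μ] {k : F → F → ℂ} {C : ℝ≥0}

theorem eLpNorm_two_sq (f : F → ℂ) : eLpNorm f 2 μ ^ 2 = ∫⁻ x, ‖f x‖ₑ ^ 2 ∂μ := by
  simpa using eLpNorm_nnreal_pow_eq_lintegral (μ := μ) (f := f) (p := 2) (by norm_num)

theorem IsSchurKernel.lintegral_sq_le (h : IsSchurKernel μ k C) {u : F → ℝ≥0∞}
    (hu : AEMeasurable u μ) :
    ∫⁻ ξ, (∫⁻ η, ‖k ξ η‖ₑ * u η ∂μ) ^ 2 ∂μ ≤ C ^ 2 * ∫⁻ η, u η ^ 2 ∂μ := by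
  have hk : Measurable fun p : F × F => ‖k p.1 p.2‖ₑ := h.stronglyMeasurable.enorm
  have key (ξ : F) : (∫⁻ η, ‖k ξ η‖ₑ * u η ∂μ) ^ 2 ≤ C * ∫⁻ η, ‖k ξ η‖ₑ * u η ^ 2 ∂μ := by
    have hkξ : Measurable fun η => ‖k ξ η‖ₑ := hk.comp measurable_prodMk_left
    have h1 := ENNReal.lintegral_mul_norm_pow_le (μ := μ) (f := fun η => ‖k ξ η‖ₑ)
      (g := fun η => ‖k ξ η‖ₑ * u η ^ 2) hkξ.aemeasurable
      (hkξ.aemeasurable.mul (hu.pow_const 2)) (p := 1/2) (q := 1/2) (by norm_num) (by norm_num)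
      (by norm_num)
    have h2 (η : F) : ‖k ξ η‖ₑ ^ (1/2 : ℝ) * (‖k ξ η‖ₑ * u η ^ 2) ^ (1/2 : ℝ) = ‖k ξ η‖ₑ * u η := by
      rw [ENNReal.mul_rpow_of_nonneg _ _ (by norm_num), ← mul_assoc,
        ← ENNReal.rpow_add_of_nonneg _ _ (by norm_num) (by norm_num), ← ENNReal.rpow_natCast,
        ← ENNReal.rpow_mul]
      norm_num
    simp only [h2] at h1
    calc _ ≤ ((∫⁻ η, ‖k ξ η‖ₑ ∂μ) ^ (1/2 : ℝ) * (∫⁻ η, ‖k ξ η‖ₑ * u η ^ 2 ∂μ) ^ (1/2 : ℝ)) ^ 2 := by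
          gcongr
      _ = (∫⁻ η, ‖k ξ η‖ₑ ∂μ) * (∫⁻ η, ‖k ξ η‖ₑ * u η ^ 2 ∂μ) := by
          rw [← ENNReal.mul_rpow_of_nonneg _ _ (by norm_num), ← ENNReal.rpow_natCast,
            ← ENNReal.rpow_mul]
          norm_num
      _ ≤ _ := by gcongr; exact h.row ξ
  calc _ ≤ ∫⁻ ξ, C * ∫⁻ η, ‖k ξ η‖ₑ * u η ^ 2 ∂μ ∂μ := lintegral_mono key
    _ = C * ∫⁻ ξ, ∫⁻ η, ‖k ξ η‖ₑ * u η ^ 2 ∂μ ∂μ := lintegral_const_mul' _ _ (by simp)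
    _ = C * ∫⁻ η, ∫⁻ ξ, ‖k ξ η‖ₑ * u η ^ 2 ∂μ ∂μ := by
        rw [lintegral_lintegral_swap]
        exact hk.aemeasurable.mul (hu.pow_const 2).comp_snd
    _ ≤ C * ∫⁻ η, C * u η ^ 2 ∂μ := by
        gcongr with η
        have hkη : Measurable fun ξ => ‖k ξ η‖ₑ := hk.comp measurable_prodMk_right
        rw [lintegral_mul_const _ hkη]
        gcongr
        exact h.col η
    _ = _ := by rw [lintegral_const_mul' _ _ (by simp), ← mul_assoc, sq]

theorem IsSchurKernel.aestronglyMeasurable (h : IsSchurKernel μ k C) {u : F → ℂ}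
    (hu : AEStronglyMeasurable u μ) :
    AEStronglyMeasurable (fun ξ => ∫ η, k ξ η * u η ∂μ) μ :=
  AEStronglyMeasurable.integral_prod_right'
    (f := fun p : F × F => k p.1 p.2 * u p.2)
    (h.stronglyMeasurable.aestronglyMeasurable.mul hu.comp_snd)

theorem IsSchurKernel.eLpNorm_le (h : IsSchurKernel μ k C) {u : F → ℂ}
    (hu : AEStronglyMeasurable u μ) :
    eLpNorm (fun ξ => ∫ η, k ξ η * u η ∂μ) 2 μ ≤ C * eLpNorm u 2 μ := by
  rw [← ENNReal.pow_le_pow_left_iff two_ne_zero, mul_pow, eLpNorm_two_sq, eLpNorm_two_sq]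
  refine le_trans (lintegral_mono fun ξ => ?_) (h.lintegral_sq_le hu.enorm)
  gcongr
  simpa only [enorm_mul] using enorm_integral_le_lintegral_enorm (fun η => k ξ η * u η) (μ := μ)

theorem IsSchurKernel.memLp_integral (h : IsSchurKernel μ k C) {u : F → ℂ} (hu : MemLp u 2 μ) :
    MemLp (fun ξ => ∫ η, k ξ η * u η ∂μ) 2 μ :=
  ⟨h.aestronglyMeasurable hu.1,
    (h.eLpNorm_le hu.1).trans_lt (ENNReal.mul_lt_top (by simp) hu.2)⟩

theorem IsSchurKernel.integrable_mul (h : IsSchurKernel μ k C) {u : F → ℂ} (hu : MemLp u 2 μ)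
    (ξ : F) : Integrable (fun η => k ξ η * u η) μ :=
  (h.memLp ξ).integrable_mul hu

/-- The integral operator `(Tu)(ξ) = ∫ k(ξ, η) u(η) dμ(η)` on `L²(μ)`, as a linear map. -/
noncomputable def kernelLin (h : IsSchurKernel μ k C) : Lp ℂ 2 μ →ₗ[ℂ] Lp ℂ 2 μ where
  toFun u := (h.memLp_integral (Lp.memLp u)).toLp
  map_add' u v := by
    rw [← MemLp.toLp_add]
    refine MemLp.toLp_congr _ _ (.of_forall fun ξ => ?_)
    simp only [Pi.add_apply]
    rw [← integral_add (h.integrable_mul (Lp.memLp u) ξ) (h.integrable_mul (Lp.memLp v) ξ)]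
    refine integral_congr_ae ?_
    filter_upwards [Lp.coeFn_add u v] with η hη
    rw [hη, Pi.add_apply, mul_add]
  map_smul' c u := by
    rw [RingHom.id_apply, ← MemLp.toLp_const_smul]
    refine MemLp.toLp_congr _ _ (.of_forall fun ξ => ?_)
    simp only [Pi.smul_apply, smul_eq_mul]
    rw [← integral_const_mul]
    refine integral_congr_ae ?_
    filter_upwards [Lp.coeFn_smul c u] with η hη
    rw [hη, Pi.smul_apply, smul_eq_mul]
    ring

theorem norm_kernelLin_le (h : IsSchurKernel μ k C) (u : Lp ℂ 2 μ) :
    ‖kernelLin h u‖ ≤ C * ‖u‖ := by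
  have h1 : ‖kernelLin h u‖ = (eLpNorm (fun ξ => ∫ η, k ξ η * u η ∂μ) 2 μ).toReal :=
    Lp.norm_toLp _ (h.memLp_integral (Lp.memLp u))
  rw [h1, Lp.norm_def, ← ENNReal.coe_toReal C, ← ENNReal.toReal_mul]
  exact ENNReal.toReal_mono (ENNReal.mul_ne_top (by simp) (Lp.memLp u).2.ne)
    (h.eLpNorm_le (Lp.memLp u).1)

/-- The bounded integral operator `(Tu)(ξ) = ∫ k(ξ, η) u(η) dμ(η)` on `L²(μ)`. -/
noncomputable def kernelOp (h : IsSchurKernel μ k C) : Lp ℂ 2 μ →L[ℂ] Lp ℂ 2 μ :=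
  (kernelLin h).mkContinuous C (norm_kernelLin_le h)

theorem kernelOp_coeFn (h : IsSchurKernel μ k C) (u : Lp ℂ 2 μ) :
    kernelOp h u =ᵐ[μ] fun ξ => ∫ η, k ξ η * u η ∂μ :=
  (h.memLp_integral (Lp.memLp u)).coeFn_toLp

theorem norm_kernelOp_le (h : IsSchurKernel μ k C) : ‖kernelOp h‖ ≤ C :=
  LinearMap.mkContinuous_norm_le _ C.2 _

theorem IsSchurKernel.lintegral_mul_lt_top (h : IsSchurKernel μ k C) {u v : F → ℂ}
    (hu : MemLp u 2 μ) (hv : MemLp v 2 μ) :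
    ∫⁻ ξ, ‖v ξ‖ₑ * ∫⁻ η, ‖k ξ η‖ₑ * ‖u η‖ₑ ∂μ ∂μ < ∞ := by
  have hk : Measurable fun p : F × F => ‖k p.1 p.2‖ₑ := h.stronglyMeasurable.enorm
  have hW : AEMeasurable (fun ξ => ∫⁻ η, ‖k ξ η‖ₑ * ‖u η‖ₑ ∂μ) μ :=
    AEMeasurable.lintegral_prod_right' (f := fun p : F × F => ‖k p.1 p.2‖ₑ * ‖u p.2‖ₑ)
      (hk.aemeasurable.mul hu.1.enorm.comp_snd)
  refine (ENNReal.lintegral_mul_le_Lp_mul_Lq μ (p := 2) (q := 2)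
    (by constructor <;> norm_num) hv.1.enorm hW).trans_lt ?_
  have h1 : ∫⁻ ξ, ‖v ξ‖ₑ ^ 2 ∂μ < ∞ := by
    rw [← eLpNorm_two_sq]; exact ENNReal.pow_lt_top hv.2
  have h2 := (h.lintegral_sq_le hu.1.enorm).trans_lt
    (ENNReal.mul_lt_top (ENNReal.pow_lt_top (by simp)) (by
      rw [← eLpNorm_two_sq]; exact ENNReal.pow_lt_top hu.2))
  refine ENNReal.mul_lt_top ?_ ?_ <;> refine ENNReal.rpow_lt_top_of_nonneg (by norm_num) ?_
  · simpa using h1.ne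
  · simpa using h2.ne

theorem IsSchurKernel.integrable_prod (h : IsSchurKernel μ k C) {u v : F → ℂ}
    (hu : MemLp u 2 μ) (hv : MemLp v 2 μ) :
    Integrable (fun p : F × F => v p.1 * (k p.1 p.2 * u p.2)) (μ.prod μ) := by
  have hm : AEStronglyMeasurable (fun p : F × F => v p.1 * (k p.1 p.2 * u p.2)) (μ.prod μ) :=
    hv.1.comp_fst.mul (h.stronglyMeasurable.aestronglyMeasurable.mul hu.1.comp_snd)
  refine ⟨hm, ?_⟩
  rw [HasFiniteIntegral, lintegral_prod _ hm.enorm]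
  refine lt_of_le_of_lt (le_of_eq ?_) (h.lintegral_mul_lt_top hu hv)
  refine lintegral_congr fun ξ => ?_
  simp only [enorm_mul]
  rw [lintegral_const_mul'']
  have hk : Measurable fun p : F × F => ‖k p.1 p.2‖ₑ := h.stronglyMeasurable.enorm
  exact (hk.comp measurable_prodMk_left).aemeasurable.mul hu.1.enorm

theorem kernelOp_adjoint {k' : F → F → ℂ} {C' : ℝ≥0} (h : IsSchurKernel μ k C)
    (h' : IsSchurKernel μ k' C') (hkk' : ∀ ξ η, k' ξ η = star (k η ξ)) :
    kernelOp h' = ContinuousLinearMap.adjoint (kernelOp h) := by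
  rw [ContinuousLinearMap.eq_adjoint_iff]
  intro v u
  rw [L2.inner_def, L2.inner_def]
  have h1 : ∀ᵐ ξ ∂μ, inner ℂ ((kernelOp h' v) ξ) (u ξ) =
      ∫ η, u ξ * (star (k' ξ η) * star (v η)) ∂μ := by
    filter_upwards [kernelOp_coeFn h' v] with ξ hξ
    rw [hξ, RCLike.inner_apply, ← integral_conj, ← integral_const_mul]
    simp
  have h2 : ∀ᵐ η ∂μ, inner ℂ (v η) ((kernelOp h u) η) =
      ∫ ξ, star (v η) * (k η ξ * u ξ) ∂μ := by
    filter_upwards [kernelOp_coeFn h u] with ξ hξ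
    rw [hξ, RCLike.inner_apply, mul_comm, ← integral_const_mul]
    simp
  rw [integral_congr_ae h1, integral_congr_ae h2]
  have := h.integrable_prod (Lp.memLp u) (Lp.memLp v).star
  rw [integral_integral_swap]
  · refine integral_congr_ae (.of_forall fun η => ?_)
    refine integral_congr_ae (.of_forall fun ξ => ?_)
    simp only [hkk', star_star]
    ring
  · refine this.swap.congr (.of_forall fun p => ?_)
    simp only [hkk', star_star, Function.comp, Prod.fst_swap, Prod.snd_swap, Function.uncurry,
      Pi.star_apply]
    ring

theorem kernelOp_mul {k₁ k₂ : F → F → ℂ} {C₁ C₂ : ℝ≥0} (h₁ : IsSchurKernel μ k₁ C₁)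
    (h₂ : IsSchurKernel μ k₂ C₂) (h : IsSchurKernel μ k C)
    (hk : ∀ ξ ζ, k ξ ζ = ∫ η, k₁ ξ η * k₂ η ζ ∂μ) :
    kernelOp h = kernelOp h₁ * kernelOp h₂ := by
  ext1 u
  rw [mul_apply_eq_comp]
  apply Lp.ext
  filter_upwards [kernelOp_coeFn h u, kernelOp_coeFn h₁ (kernelOp h₂ u)] with ξ hξ hξ'
  rw [hξ, hξ']
  have h1 : ∫ η, k₁ ξ η * (kernelOp h₂ u) η ∂μ =
      ∫ η, ∫ ζ, k₁ ξ η * (k₂ η ζ * u ζ) ∂μ ∂μ := by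
    refine integral_congr_ae ?_
    filter_upwards [kernelOp_coeFn h₂ u] with η hη
    rw [hη, integral_const_mul]
  rw [h1, integral_integral_swap (h₂.integrable_prod (Lp.memLp u) (h₁.memLp ξ))]
  refine integral_congr_ae (.of_forall fun ζ => ?_)
  simp only [hk]
  rw [← integral_mul_const]
  simp only [mul_assoc]

end Kernel

/-- On `σ`-compact locally compact Hausdorff spaces, jointly continuous functions are measurable
for the product of the Borel `σ`-algebras. -/
theorem stronglyMeasurable_of_continuous_prod {F : Type*} [TopologicalSpace F] [MeasurableSpace F]
    [BorelSpace F] [T2Space F] [LocallyCompactSpace F] [SigmaCompactSpace F] {k : F × F → ℂ}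
    (hk : Continuous k) : StronglyMeasurable k := by
  have hφ (n : ℕ) : ∃ φ : C(F, ℝ), Set.EqOn φ 1 (compactCovering F n) ∧ HasCompactSupport φ := by
    obtain ⟨φ, h1, h2, -⟩ := exists_continuousMap_one_of_isCompact_subset_isOpen
      (isCompact_compactCovering F n) isOpen_univ (Set.subset_univ _)
    exact ⟨φ, h1, h2⟩
  choose φ hφ1 hφ2 using hφ
  refine stronglyMeasurable_of_tendsto (u := atTop)
    (f := fun (n : ℕ) (p : F × F) => (((φ n p.1 * φ n p.2 : ℝ) : ℂ)) * k p) (fun n => ?_) ?_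
  · refine HasCompactSupport.stronglyMeasurable_of_prod (by fun_prop) ?_
    refine HasCompactSupport.intro ((hφ2 n).isCompact.prod (hφ2 n).isCompact) fun p hp => ?_
    rw [Set.mem_prod, not_and_or] at hp
    rcases hp with hp | hp <;> simp [image_eq_zero_of_notMem_tsupport hp]
  · rw [tendsto_pi_nhds]
    intro p
    obtain ⟨n, hn⟩ := Set.mem_iUnion.1 ((iUnion_compactCovering F).symm ▸ Set.mem_univ p.1)
    obtain ⟨m, hm⟩ := Set.mem_iUnion.1 ((iUnion_compactCovering F).symm ▸ Set.mem_univ p.2)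
    refine tendsto_const_nhds.congr' ?_
    filter_upwards [eventually_ge_atTop n, eventually_ge_atTop m] with i hi hi'
    rw [hφ1 i (compactCovering_subset F hi hn), hφ1 i (compactCovering_subset F hi' hm)]
    simp

section Regular

variable {X : Type u} [Groupoid.{v} X] [TopologicalSpace X] [TopologicalSpace (Arr X)]

instance (H : HaarSystem X) (x : X) : (H.meas x).Regular := H.regular x

instance (H : HaarSystem X) (x : X) : (H.meas x).IsOpenPosMeasure := H.fullSupport x

/-- The Hilbert space `ℋ_x = L²(Ξ_x; λ_x)`. -/
abbrev HaarSystem.L2 (H : HaarSystem X) (x : X) : Type _ := Lp ℂ 2 (H.meas x)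

variable [TopGroupoid X] [T2Space (Arr X)]

instance (x : X) : T2Space (Fibre x) := (Fibre.isClosedEmbedding_toArr x).isEmbedding.t2Space

instance [LocallyCompactSpace (Arr X)] (x : X) : LocallyCompactSpace (Fibre x) :=
  (Fibre.isClosedEmbedding_toArr x).locallyCompactSpace

instance [SigmaCompactSpace (Arr X)] (x : X) : SigmaCompactSpace (Fibre x) :=
  (Fibre.isClosedEmbedding_toArr x).sigmaCompactSpace

/-- The twisted convolution
`(f ⋆ u)(ξ) = ∫ f(ξη⁻¹) u(η) ω(ξη⁻¹, η) dλ_x(η)` of `f : Ξ → ℂ` with a function `u` on `Ξ_x`. -/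
noncomputable def convFibre (H : HaarSystem X) (ω : TwoCocycle X) (f : Arr X → ℂ) {x : X}
    (u : Fibre x → ℂ) (ξ : Fibre x) : ℂ :=
  ∫ η : Fibre x,
    f (ξ.mulInv η) * u η * (ω.app (Groupoid.inv η.hom ≫ ξ.hom) η.hom : ℂ) ∂(H.meas x)

/-- The integral kernel of `u ↦ f ⋆ u`. -/
noncomputable def convKernel (ω : TwoCocycle X) (f : Arr X → ℂ) {x : X} (ξ η : Fibre x) : ℂ :=
  f (ξ.mulInv η) * (ω.app (Groupoid.inv η.hom ≫ ξ.hom) η.hom : ℂ)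

theorem convFibre_eq (H : HaarSystem X) (ω : TwoCocycle X) (f : Arr X → ℂ) {x : X}
    (u : Fibre x → ℂ) (ξ : Fibre x) :
    convFibre H ω f u ξ = ∫ η : Fibre x, convKernel ω f ξ η * u η ∂(H.meas x) := by
  simp only [convFibre, convKernel]
  congr 1
  ext η
  ring

theorem continuous_circle_coe : Continuous fun z : Circle => (z : ℂ) := by
  fun_prop

theorem continuous_cocycle_par (ω : TwoCocycle X) :
    Continuous fun p : Par X => (ω.app (Groupoid.inv p.snd.hom ≫ p.fst.hom) p.snd.hom : ℂ) :=
  continuous_circle_coe.comp (ω.continuous_app.comp Par.continuous_toComp)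

theorem continuous_convKernel (ω : TwoCocycle X) (f : C_c(Arr X, ℂ)) (x : X) :
    Continuous fun p : Fibre x × Fibre x => convKernel ω f p.1 p.2 :=
  (f.continuous.comp (Fibre.continuous_mulInv x)).mul
    ((continuous_cocycle_par ω).comp (Par.continuous_of_fibre x))

/-- Right translation is a homeomorphism of fibres. -/
def Fibre.rightMulHomeo {x y : X} (ξ : x ⟶ y) : Fibre y ≃ₜ Fibre x where
  toFun := Fibre.rightMul ξ
  invFun := Fibre.rightMul (Groupoid.inv ξ)
  left_inv η := by simp [Fibre.rightMul]
  right_inv η := by simp [Fibre.rightMul]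
  continuous_toFun := Fibre.continuous_rightMul ξ
  continuous_invFun := Fibre.continuous_rightMul _

theorem Fibre.measurableEmbedding_rightMul {x y : X} (ξ : x ⟶ y) :
    MeasurableEmbedding (Fibre.rightMul ξ : Fibre y → Fibre x) :=
  (Fibre.rightMulHomeo ξ).measurableEmbedding

theorem Fibre.mulInv_rightMul {x : X} (ξ : Fibre x) (κ : Fibre ξ.tgt) :
    (Fibre.rightMul ξ.hom κ).mulInv ξ = κ.toArr := by
  simp [Fibre.rightMul, Fibre.mulInv, Fibre.toArr]

theorem Fibre.mulInv_rightMul' {x : X} (ξ : Fibre x) (κ : Fibre ξ.tgt) :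
    ξ.mulInv (Fibre.rightMul ξ.hom κ) = κ.toArr.inv := by
  simp [Fibre.rightMul, Fibre.mulInv, Fibre.toArr, Arr.inv]

theorem Fibre.isClosedEmbedding_mulInv {x : X} (ξ : Fibre x) :
    IsClosedEmbedding (fun η => ξ.mulInv η) := by
  have h : (fun η => ξ.mulInv η) =
      Arr.inv ∘ Fibre.toArr ∘ Fibre.rightMulHomeo (Groupoid.inv ξ.hom) := by
    ext1 η
    simp [Fibre.rightMulHomeo, Fibre.rightMul, Fibre.mulInv, Fibre.toArr, Arr.inv]
  rw [h]
  exact Arr.isClosedEmbedding_inv.comp ((Fibre.isClosedEmbedding_toArr _).comp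
    (Fibre.rightMulHomeo _).isClosedEmbedding)

theorem lintegral_rightMul (H : HaarSystem X) {x y : X} (ξ : x ⟶ y) (F : Fibre x → ℝ≥0∞) :
    ∫⁻ η, F η ∂(H.meas x) = ∫⁻ κ, F (Fibre.rightMul ξ κ) ∂(H.meas y) := by
  rw [← H.map_rightMul ξ, (Fibre.measurableEmbedding_rightMul ξ).lintegral_map]

theorem integral_rightMul (H : HaarSystem X) {x y : X} (ξ : x ⟶ y) (F : Fibre x → ℂ) :
    ∫ η, F η ∂(H.meas x) = ∫ κ, F (Fibre.rightMul ξ κ) ∂(H.meas y) := by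
  rw [← H.map_rightMul ξ, (Fibre.measurableEmbedding_rightMul ξ).integral_map]

theorem integrable_restrict (H : HaarSystem X) (f : C_c(Arr X, ℂ)) (x : X) :
    Integrable (fun η : Fibre x => f η.toArr) (H.meas x) :=
  (f.continuous.comp (Fibre.continuous_toArr x)).integrable_of_hasCompactSupport
    (f.hasCompactSupport.comp_isClosedEmbedding (Fibre.isClosedEmbedding_toArr x))

/-- The pointwise absolute value of `f`. -/
noncomputable def absCc (f : C_c(Arr X, ℂ)) : C_c(Arr X, ℂ) where
  toFun ξ := (‖f ξ‖ : ℂ)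
  continuous_toFun := by fun_prop
  hasCompactSupport' := f.hasCompactSupport.comp_left (g := fun z : ℂ => (‖z‖ : ℂ)) (by simp)

theorem exists_fibre_bound (H : HaarSystem X) (f : C_c(Arr X, ℂ)) :
    ∃ C : ℝ≥0, ∀ x, ∫⁻ η : Fibre x, ‖f η.toArr‖ₑ ∂(H.meas x) ≤ C := by
  have := t2Space_units (X := X)
  have hc := H.continuous_integral (absCc f)
  have hs : HasCompactSupport fun x => ∫ η : Fibre x, absCc f η.toArr ∂(H.meas x) := by
    refine HasCompactSupport.intro
      (f.hasCompactSupport.isCompact.image TopGroupoid.continuous_src) fun x hx => ?_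
    have : ∀ η : Fibre x, absCc f η.toArr = 0 := fun η => by
      have : f η.toArr = 0 := by
        by_contra h
        exact hx ⟨η.toArr, subset_tsupport _ h, rfl⟩
      simp [absCc, this]
    simp [this]
  obtain ⟨C, hC⟩ := hs.exists_bound_of_continuous hc
  refine ⟨C.toNNReal, fun x => ?_⟩
  rw [← ofReal_integral_norm_eq_lintegral_enorm (integrable_restrict H f x)]
  refine ENNReal.ofReal_le_ofReal (le_trans ?_ (hC x))
  have : ∫ η : Fibre x, absCc f η.toArr ∂(H.meas x) =
      ((∫ η : Fibre x, ‖f η.toArr‖ ∂(H.meas x) : ℝ) : ℂ) := by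
    rw [← integral_complex_ofReal]; rfl
  rw [this, Complex.norm_real]
  exact le_abs_self _

/-- `ξ ↦ f(ξ⁻¹)`. -/
noncomputable def invCc (f : C_c(Arr X, ℂ)) : C_c(Arr X, ℂ) where
  toFun ξ := f ξ.inv
  continuous_toFun := f.continuous.comp TopGroupoid.continuous_inv
  hasCompactSupport' := f.hasCompactSupport.comp_isClosedEmbedding Arr.isClosedEmbedding_inv

theorem exists_isSchurKernel [LocallyCompactSpace (Arr X)] [SigmaCompactSpace (Arr X)]
    (H : HaarSystem X) (ω : TwoCocycle X) (f : C_c(Arr X, ℂ)) :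
    ∃ C : ℝ≥0, ∀ x, IsSchurKernel (H.meas x) (convKernel ω f) C := by
  obtain ⟨C₁, h₁⟩ := exists_fibre_bound H f
  obtain ⟨C₂, h₂⟩ := exists_fibre_bound H (invCc f)
  have hn {x : X} (ξ η : Fibre x) : ‖convKernel ω f ξ η‖ₑ = ‖f (ξ.mulInv η)‖ₑ := by
    rw [convKernel, ← ofReal_norm, norm_mul, Circle.norm_coe, mul_one, ofReal_norm]
  refine ⟨max C₁ C₂, fun x => ⟨stronglyMeasurable_of_continuous_prod
    (continuous_convKernel ω f x), fun ξ => ?_, fun η => ?_, fun ξ => ?_⟩⟩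
  · simp only [hn]
    rw [lintegral_rightMul H ξ.hom]
    simp only [Fibre.mulInv_rightMul']
    exact (h₂ _).trans (by simp)
  · simp only [hn]
    rw [lintegral_rightMul H η.hom]
    simp only [Fibre.mulInv_rightMul]
    exact (h₁ _).trans (by simp)
  · refine Continuous.memLp_of_hasCompactSupport
      ((continuous_convKernel ω f x).comp (Continuous.prodMk_right ξ)) ?_
    exact HasCompactSupport.mul_right
      (f.hasCompactSupport.comp_isClosedEmbedding ξ.isClosedEmbedding_mulInv)

variable [LocallyCompactSpace (Arr X)] [SigmaCompactSpace (Arr X)]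

/-- The operator `Π_x(f) u = f ⋆ u` on `L²(Ξ_x; λ_x)`, for `f ∈ C_c(Ξ)`. -/
noncomputable def regularRep (H : HaarSystem X) (ω : TwoCocycle X) (x : X) (f : C_c(Arr X, ℂ)) :
    H.L2 x →L[ℂ] H.L2 x :=
  kernelOp ((exists_isSchurKernel H ω f).choose_spec x)

theorem regularRep_coeFn (H : HaarSystem X) (ω : TwoCocycle X) (x : X) (f : C_c(Arr X, ℂ))
    (u : H.L2 x) : regularRep H ω x f u =ᵐ[H.meas x] convFibre H ω f u := by
  filter_upwards [kernelOp_coeFn ((exists_isSchurKernel H ω f).choose_spec x) u] with ξ hξ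
  rw [regularRep, hξ, convFibre_eq]

theorem exists_norm_regularRep_le (H : HaarSystem X) (ω : TwoCocycle X) (f : C_c(Arr X, ℂ)) :
    ∃ C : ℝ, ∀ x, ‖regularRep H ω x f‖ ≤ C :=
  ⟨_, fun x => norm_kernelOp_le ((exists_isSchurKernel H ω f).choose_spec x)⟩

/-- The involution `f^⋆(ξ) = conj ω(ξ, ξ⁻¹) conj f(ξ⁻¹)` of `C_c(Ξ, ω)`. -/
noncomputable def starCc (ω : TwoCocycle X) (f : C_c(Arr X, ℂ)) : C_c(Arr X, ℂ) where
  toFun ξ := star (ω.app ξ.hom (Groupoid.inv ξ.hom) : ℂ) * star (f ξ.inv)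
  continuous_toFun := by
    have h : Continuous (fun ξ : Arr X =>
        (⟨ξ.tgt, ξ.src, ξ.tgt, ξ.hom, Groupoid.inv ξ.hom⟩ : Comp X)) := by
      rw [Comp.continuous_iff]
      exact ⟨continuous_id, TopGroupoid.continuous_inv⟩
    exact (continuous_circle_coe.comp (ω.continuous_app.comp h)).star.mul
      (f.continuous.comp TopGroupoid.continuous_inv).star
  hasCompactSupport' := HasCompactSupport.mul_left
    ((f.hasCompactSupport.comp_isClosedEmbedding Arr.isClosedEmbedding_inv).comp_left
      (g := fun z : ℂ => star z) (by simp))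

theorem cocycle_inv (ω : TwoCocycle X) {x y : X} (a : x ⟶ y) :
    ω.app a (Groupoid.inv a) = ω.app (Groupoid.inv a) a := by
  have h := ω.cocycle a (Groupoid.inv a) a
  rw [Groupoid.inv_comp, Groupoid.comp_inv, ω.unit_left, ω.unit_right, mul_one, mul_one] at h
  exact h

theorem convKernel_starCc (ω : TwoCocycle X) (f : C_c(Arr X, ℂ)) {x : X} (ξ η : Fibre x) :
    convKernel ω (starCc ω f) ξ η = star (convKernel ω f η ξ) := by
  have h1 : (ξ.mulInv η).inv = η.mulInv ξ := by
    simp [Arr.inv, Fibre.mulInv]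
  have h2 := ω.cocycle (Groupoid.inv ξ.hom ≫ η.hom) (Groupoid.inv η.hom ≫ ξ.hom) η.hom
  have h3 : (Groupoid.inv η.hom ≫ ξ.hom) ≫ Groupoid.inv ξ.hom ≫ η.hom = 𝟙 _ := by simp
  have h4 : η.hom ≫ Groupoid.inv η.hom ≫ ξ.hom = ξ.hom := by simp
  have h5 : Groupoid.inv (Groupoid.inv η.hom ≫ ξ.hom) = Groupoid.inv ξ.hom ≫ η.hom := by simp
  rw [h3, h4, ω.unit_left, mul_one] at h2
  have h6 : ω.app (Groupoid.inv η.hom ≫ ξ.hom) (Groupoid.inv (Groupoid.inv η.hom ≫ ξ.hom)) =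
      ω.app (Groupoid.inv ξ.hom ≫ η.hom) (Groupoid.inv η.hom ≫ ξ.hom) := by
    rw [cocycle_inv, h5]
  have h7 : star (ω.app (Groupoid.inv η.hom ≫ ξ.hom)
      (Groupoid.inv (Groupoid.inv η.hom ≫ ξ.hom)) : ℂ) *
      (ω.app (Groupoid.inv η.hom ≫ ξ.hom) η.hom : ℂ) =
      star (ω.app (Groupoid.inv ξ.hom ≫ η.hom) ξ.hom : ℂ) := by
    rw [h6, h2]
    have hn : ∀ z : Circle, star (z : ℂ) = ((z⁻¹ : Circle) : ℂ) := fun z =>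
      (Circle.coe_inv_eq_conj z).symm
    rw [hn, hn, ← Circle.coe_mul]
    congr 1
    rw [mul_comm, mul_inv, mul_inv_cancel_left]
  have h8 : convKernel ω (starCc ω f) ξ η = star (ω.app (Groupoid.inv η.hom ≫ ξ.hom)
      (Groupoid.inv (Groupoid.inv η.hom ≫ ξ.hom)) : ℂ) * star (f (ξ.mulInv η).inv) *
      (ω.app (Groupoid.inv η.hom ≫ ξ.hom) η.hom : ℂ) := rfl
  rw [h8, h1, mul_right_comm, h7]
  simp only [convKernel, star_mul']
  ring

theorem regularRep_starCc (H : HaarSystem X) (ω : TwoCocycle X) (x : X) (f : C_c(Arr X, ℂ)) :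
    regularRep H ω x (starCc ω f) = star (regularRep H ω x f) :=
  kernelOp_adjoint _ _ fun ξ η => convKernel_starCc ω f ξ η

/-- A parametrized integral of a jointly continuous function against a Haar system, cut off by a
compactly supported function, depends continuously on the parameter. -/
theorem continuous_integral_param (H : HaarSystem X) (G : C(Arr X × Arr X, ℂ))
    (ψ : C_c(Arr X, ℂ)) :
    Continuous fun ξ : Arr X =>
      ∫ η : Fibre ξ.src, G (ξ, η.toArr) * ψ η.toArr ∂(H.meas ξ.src) := by
  have hint (ζ : Arr X) (x : X) :
      Integrable (fun η : Fibre x => G (ζ, η.toArr) * ψ η.toArr) (H.meas x) := by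
    let g : C_c(Arr X, ℂ) :=
      { toFun := fun η => G (ζ, η) * ψ η
        continuous_toFun := by fun_prop
        hasCompactSupport' := ψ.hasCompactSupport.mul_left }
    exact integrable_restrict H g x
  rw [continuous_iff_continuousAt]
  intro ξ₀
  obtain ⟨C, hC⟩ := exists_fibre_bound H ψ
  have hC' (x : X) : ∫ η : Fibre x, ‖ψ η.toArr‖ ∂(H.meas x) ≤ C := by
    have := hC x
    rw [← ofReal_integral_norm_eq_lintegral_enorm (integrable_restrict H ψ x)] at this
    simpa using (ENNReal.ofReal_le_iff_le_toReal (by simp)).1 this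
  have h1 : Tendsto (fun ξ : Arr X =>
      ∫ η : Fibre ξ.src, G (ξ₀, η.toArr) * ψ η.toArr ∂(H.meas ξ.src)) (𝓝 ξ₀)
      (𝓝 (∫ η : Fibre ξ₀.src, G (ξ₀, η.toArr) * ψ η.toArr ∂(H.meas ξ₀.src))) := by
    let g : C_c(Arr X, ℂ) :=
      { toFun := fun η => G (ξ₀, η) * ψ η
        continuous_toFun := by fun_prop
        hasCompactSupport' := ψ.hasCompactSupport.mul_left }
    exact ((H.continuous_integral g).comp TopGroupoid.continuous_src).tendsto ξ₀
  have h2 : Tendsto (fun ξ : Arr X =>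
      ∫ η : Fibre ξ.src, (G (ξ, η.toArr) - G (ξ₀, η.toArr)) * ψ η.toArr ∂(H.meas ξ.src)) (𝓝 ξ₀)
      (𝓝 0) := by
    rw [Metric.tendsto_nhds]
    intro ε hε
    have hδ : 0 < ε / (C + 1) := by positivity
    obtain ⟨v, hv, hvk⟩ := ψ.hasCompactSupport.isCompact.mem_uniformity_of_prod
      (f := fun ξ η => G (ξ, η)) (s := Set.univ) (q := ξ₀)
      (G.continuous.continuousOn) (Set.mem_univ _) (Metric.dist_mem_uniformity hδ)
    rw [nhdsWithin_univ] at hv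
    filter_upwards [hv] with ξ hξ
    rw [dist_zero_right]
    have hle : ‖∫ η : Fibre ξ.src, (G (ξ, η.toArr) - G (ξ₀, η.toArr)) * ψ η.toArr
        ∂(H.meas ξ.src)‖ ≤ ∫ η : Fibre ξ.src, ε / (C + 1) * ‖ψ η.toArr‖ ∂(H.meas ξ.src) := by
      refine norm_integral_le_of_norm_le ((integrable_restrict H ψ _).norm.const_mul _)
        (.of_forall fun η => ?_)
      rw [norm_mul]
      by_cases hη : η.toArr ∈ tsupport ψ
      · gcongr
        have := hvk ξ hξ η.toArr hη
        simp only [Set.mem_ofPred_eq, dist_eq_norm] at this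
        exact this.le
      · simp [image_eq_zero_of_notMem_tsupport hη]
    refine hle.trans_lt ?_
    rw [integral_const_mul]
    calc ε / (C + 1) * ∫ η : Fibre ξ.src, ‖ψ η.toArr‖ ∂(H.meas ξ.src) ≤ ε / (C + 1) * C := by
          gcongr; exact hC' _
      _ < ε := by
          rw [div_mul_eq_mul_div, div_lt_iff₀ (by positivity)]
          nlinarith
  have h3 := h2.add h1
  rw [zero_add] at h3
  refine h3.congr fun ξ => ?_
  rw [← integral_add]
  · simp only [sub_mul, sub_add_cancel]
  · simp only [sub_mul]
    exact (hint ξ _).sub (hint ξ₀ _)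
  · exact hint ξ₀ _

/-- The twisted convolution product `f ⋆ g` of `C_c(Ξ, ω)`,
`(f ⋆ g)(ξ) = ∫ f(ξη⁻¹) g(η) ω(ξη⁻¹, η) dλ_{d(ξ)}(η)`. -/
noncomputable def convCc (H : HaarSystem X) (ω : TwoCocycle X) (f g : C_c(Arr X, ℂ)) :
    C_c(Arr X, ℂ) where
  toFun ξ := convFibre H ω f (fun η => g η.toArr) ξ.toFibre
  continuous_toFun := by
    obtain ⟨φ, hφ1, hφ2, -⟩ := exists_continuousMap_one_of_isCompact_subset_isOpen
      g.hasCompactSupport.isCompact isOpen_univ (Set.subset_univ _)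
    let ψ : C_c(Arr X, ℂ) :=
      { toFun := fun η => (φ η : ℂ)
        continuous_toFun := by fun_prop
        hasCompactSupport' := HasCompactSupport.comp_left (g := fun z : ℝ => (z : ℂ)) hφ2 (by simp) }
    let h : C(Par X, ℂ) :=
      { toFun := fun p => f (p.fst.mulInv p.snd) * g p.snd.toArr *
          (ω.app (Groupoid.inv p.snd.hom ≫ p.fst.hom) p.snd.hom : ℂ)
        continuous_toFun := by
          have h1 : Continuous fun p : Par X => p.fst.mulInv p.snd :=
            (Comp.continuous_iff.1 Par.continuous_toComp).1
          exact ((f.continuous.comp h1).mul (g.continuous.comp Par.continuous_snd)).mul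
            (continuous_cocycle_par ω) }
    obtain ⟨G, hG⟩ := ContinuousMap.exists_extension (Par.isClosedEmbedding_pair (X := X)) h
    have hG' (p : Par X) : G (p.fst.toArr, p.snd.toArr) = h p := DFunLike.congr_fun hG p
    refine (continuous_integral_param H G ψ).congr fun ξ => ?_
    simp only [convFibre]
    refine integral_congr_ae (.of_forall fun η => ?_)
    have h1 : G (ξ, η.toArr) = h ⟨ξ.src, ξ.toFibre, η⟩ := hG' ⟨ξ.src, ξ.toFibre, η⟩
    simp only [h1]
    by_cases hη : η.toArr ∈ tsupport g
    · have : ψ η.toArr = 1 := by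
        change ((φ η.toArr : ℝ) : ℂ) = 1
        rw [hφ1 hη]; simp
      rw [this, mul_one]; rfl
    · have : g η.toArr = 0 := image_eq_zero_of_notMem_tsupport hη
      have h2 : h ⟨ξ.src, ξ.toFibre, η⟩ = 0 := by
        change _ * g η.toArr * _ = 0
        rw [this]; simp
      rw [h2, this]; simp
  hasCompactSupport' := by
    have hK : IsCompact ((fun p : Comp X => (p.fst, p.snd)) ⁻¹' (tsupport f ×ˢ tsupport g)) :=
      Comp.isClosedEmbedding_pair.isCompact_preimage
        (f.hasCompactSupport.isCompact.prod g.hasCompactSupport.isCompact)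
    refine HasCompactSupport.intro (hK.image TopGroupoid.continuous_mul) fun ξ hξ => ?_
    simp only [convFibre]
    refine integral_eq_zero_of_ae (.of_forall fun η => ?_)
    simp only [Pi.zero_apply, mul_eq_zero]
    left
    by_contra hne
    rw [not_or] at hne
    refine hξ ⟨(⟨ξ.src, ξ.toFibre, η⟩ : Par X).toComp,
      ⟨subset_tsupport _ hne.1, subset_tsupport _ hne.2⟩, ?_⟩
    simp [Comp.mul, Par.toComp, Arr.toFibre]

theorem convKernel_convCc (H : HaarSystem X) (ω : TwoCocycle X) (f g : C_c(Arr X, ℂ)) {x : X}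
    (ξ ζ : Fibre x) :
    convKernel ω (convCc H ω f g) ξ ζ =
      ∫ η, convKernel ω f ξ η * convKernel ω g η ζ ∂(H.meas x) := by
  rw [integral_rightMul H ζ.hom]
  have h0 : convKernel ω (convCc H ω f g) ξ ζ =
      (∫ κ : Fibre ζ.tgt, f ((ξ.mulInv ζ).toFibre.mulInv κ) * g κ.toArr *
        (ω.app (Groupoid.inv κ.hom ≫ Groupoid.inv ζ.hom ≫ ξ.hom) κ.hom : ℂ) ∂(H.meas ζ.tgt)) *
        (ω.app (Groupoid.inv ζ.hom ≫ ξ.hom) ζ.hom : ℂ) := rfl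
  rw [h0, ← integral_mul_const]
  refine integral_congr_ae (.of_forall fun κ => ?_)
  have h1 : (ξ.mulInv ζ).toFibre.mulInv κ = ξ.mulInv (Fibre.rightMul ζ.hom κ) := by
    simp [Fibre.mulInv, Fibre.rightMul, Arr.toFibre]
  have h2 := Fibre.mulInv_rightMul ζ κ
  have h3 := ω.cocycle (Groupoid.inv κ.hom ≫ Groupoid.inv ζ.hom ≫ ξ.hom) κ.hom ζ.hom
  have h4 : κ.hom ≫ Groupoid.inv κ.hom ≫ Groupoid.inv ζ.hom ≫ ξ.hom =
    Groupoid.inv ζ.hom ≫ ξ.hom := by simp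
  have h5 : Groupoid.inv ζ.hom ≫ ζ.hom ≫ κ.hom = κ.hom := by simp
  have h6 : Groupoid.inv (ζ.hom ≫ κ.hom) ≫ ξ.hom =
    Groupoid.inv κ.hom ≫ Groupoid.inv ζ.hom ≫ ξ.hom := by simp
  rw [h4] at h3
  have h3' := congrArg (fun z : Circle => (z : ℂ)) h3
  simp only [Circle.coe_mul] at h3'
  have e1 : convKernel ω f ξ (Fibre.rightMul ζ.hom κ) =
      f (ξ.mulInv (Fibre.rightMul ζ.hom κ)) *
        (ω.app (Groupoid.inv (ζ.hom ≫ κ.hom) ≫ ξ.hom) (ζ.hom ≫ κ.hom) : ℂ) := rfl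
  have e2 : convKernel ω g (Fibre.rightMul ζ.hom κ) ζ =
      g ((Fibre.rightMul ζ.hom κ).mulInv ζ) *
        (ω.app (Groupoid.inv ζ.hom ≫ ζ.hom ≫ κ.hom) ζ.hom : ℂ) := rfl
  simp only [e1, e2, h1, h2, h5, h6]
  linear_combination (f (ξ.mulInv (Fibre.rightMul ζ.hom κ)) * g κ.toArr) * h3'

theorem regularRep_convCc (H : HaarSystem X) (ω : TwoCocycle X) (x : X) (f g : C_c(Arr X, ℂ)) :
    regularRep H ω x (convCc H ω f g) = regularRep H ω x f * regularRep H ω x g :=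
  kernelOp_mul _ _ _ fun ξ ζ => convKernel_convCc H ω f g ξ ζ

theorem regularRep_add (H : HaarSystem X) (ω : TwoCocycle X) (x : X) (f g : C_c(Arr X, ℂ)) :
    regularRep H ω x (f + g) = regularRep H ω x f + regularRep H ω x g := by
  ext1 u
  apply Lp.ext
  rw [add_apply]
  filter_upwards [kernelOp_coeFn ((exists_isSchurKernel H ω (f + g)).choose_spec x) u,
    kernelOp_coeFn ((exists_isSchurKernel H ω f).choose_spec x) u,
    kernelOp_coeFn ((exists_isSchurKernel H ω g).choose_spec x) u,
    Lp.coeFn_add (regularRep H ω x f u) (regularRep H ω x g u)] with ξ h1 h2 h3 h4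
  rw [h4, Pi.add_apply, regularRep, h1, regularRep, h2, regularRep, h3, ← integral_add
    (((exists_isSchurKernel H ω f).choose_spec x).integrable_mul (Lp.memLp u) ξ)
    (((exists_isSchurKernel H ω g).choose_spec x).integrable_mul (Lp.memLp u) ξ)]
  congr 1
  ext1 η
  simp only [convKernel, CompactlySupportedContinuousMap.coe_add, Pi.add_apply]
  ring

theorem regularRep_smul (H : HaarSystem X) (ω : TwoCocycle X) (x : X) (c : ℂ)
    (f : C_c(Arr X, ℂ)) : regularRep H ω x (c • f) = c • regularRep H ω x f := by
  ext1 u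
  apply Lp.ext
  rw [smul_apply]
  filter_upwards [kernelOp_coeFn ((exists_isSchurKernel H ω (c • f)).choose_spec x) u,
    kernelOp_coeFn ((exists_isSchurKernel H ω f).choose_spec x) u,
    Lp.coeFn_smul c (regularRep H ω x f u)] with ξ h1 h2 h4
  rw [h4, Pi.smul_apply, regularRep, h1, regularRep, h2, smul_eq_mul, ← integral_const_mul]
  congr 1
  ext1 η
  simp only [convKernel, CompactlySupportedContinuousMap.coe_smul, Pi.smul_apply, smul_eq_mul]
  ring

/-- The `C^*`-algebra of bounded families `(T_x)_{x ∈ X}` of operators `T_x ∈ 𝔹(ℋ_x)`, with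
pointwise operations and the norm `sup_x ‖T_x‖`. -/
def BoundedFamily (H : HaarSystem X) : Type _ :=
  lp (fun x : X => H.L2 x →L[ℂ] H.L2 x) ∞

set_option synthInstance.maxHeartbeats 400000 in
noncomputable instance (H : HaarSystem X) : NonUnitalCStarAlgebra (BoundedFamily H) :=
  inferInstanceAs (NonUnitalCStarAlgebra (lp (fun x : X => H.L2 x →L[ℂ] H.L2 x) ∞))

/-- The member `T_x` of a bounded family of operators. -/
def BoundedFamily.eval {H : HaarSystem X} (T : BoundedFamily H) (x : X) : H.L2 x →L[ℂ] H.L2 x :=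
  (show lp (fun x : X => H.L2 x →L[ℂ] H.L2 x) ∞ from T) x

theorem BoundedFamily.ext {H : HaarSystem X} {S T : BoundedFamily H}
    (h : ∀ x, S.eval x = T.eval x) : S = T :=
  lp.ext (funext h)

theorem BoundedFamily.norm_eq {H : HaarSystem X} (T : BoundedFamily H) :
    ‖T‖ = ⨆ x, ‖T.eval x‖ :=
  lp.norm_eq_ciSup _

theorem BoundedFamily.eval_add {H : HaarSystem X} (S T : BoundedFamily H) (x : X) :
    (S + T).eval x = S.eval x + T.eval x := rfl

theorem BoundedFamily.eval_mul {H : HaarSystem X} (S T : BoundedFamily H) (x : X) :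
    (S * T).eval x = S.eval x * T.eval x := rfl

theorem BoundedFamily.eval_smul {H : HaarSystem X} (c : ℂ) (T : BoundedFamily H) (x : X) :
    (c • T).eval x = c • T.eval x := rfl

theorem BoundedFamily.eval_star {H : HaarSystem X} (T : BoundedFamily H) (x : X) :
    (star T).eval x = star (T.eval x) := rfl

theorem BoundedFamily.eval_zero {H : HaarSystem X} (x : X) :
    (0 : BoundedFamily H).eval x = 0 := rfl

/-- The family `(Π_x(f))_x` of regular representations of `f ∈ C_c(Ξ)`. -/
noncomputable def regularFamily (H : HaarSystem X) (ω : TwoCocycle X) (f : C_c(Arr X, ℂ)) :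
    BoundedFamily H :=
  (⟨fun x => regularRep H ω x f, memℓp_infty (by
    obtain ⟨C, hC⟩ := exists_norm_regularRep_le H ω f
    exact ⟨C, by rintro _ ⟨x, rfl⟩; exact hC x⟩)⟩ : lp (fun x : X => H.L2 x →L[ℂ] H.L2 x) ∞)

theorem eval_regularFamily (H : HaarSystem X) (ω : TwoCocycle X) (f : C_c(Arr X, ℂ)) (x : X) :
    (regularFamily H ω f).eval x = regularRep H ω x f := rfl

/-- The image of the `*`-algebra `C_c(Ξ, ω)` under `f ↦ (Π_x(f))_x`. -/
noncomputable def regularRange (H : HaarSystem X) (ω : TwoCocycle X) :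
    NonUnitalStarSubalgebra ℂ (BoundedFamily H) where
  carrier := Set.range (regularFamily H ω)
  add_mem' := by
    rintro _ _ ⟨f, rfl⟩ ⟨g, rfl⟩
    exact ⟨f + g, BoundedFamily.ext fun x => regularRep_add H ω x f g⟩
  zero_mem' := ⟨0, BoundedFamily.ext fun x => by
    have := regularRep_smul H ω x 0 0
    rw [zero_smul, zero_smul] at this
    exact this⟩
  mul_mem' := by
    rintro _ _ ⟨f, rfl⟩ ⟨g, rfl⟩
    exact ⟨convCc H ω f g, BoundedFamily.ext fun x => regularRep_convCc H ω x f g⟩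
  smul_mem' := by
    rintro c _ ⟨f, rfl⟩
    exact ⟨c • f, BoundedFamily.ext fun x => regularRep_smul H ω x c f⟩
  star_mem' := by
    rintro _ ⟨f, rfl⟩
    exact ⟨starCc ω f, BoundedFamily.ext fun x => regularRep_starCc H ω x f⟩

/-- The reduced twisted groupoid `C^*`-algebra `C^*_r(Ξ, ω)`: the completion of `C_c(Ξ, ω)` in the
reduced norm `‖f‖ = sup_x ‖Π_x(f)‖`, realized as the norm closure of the image of `C_c(Ξ, ω)`
under the map `f ↦ (Π_x(f))_x` (which is isometric for that norm) in the `C^*`-algebra of bounded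
families of operators. -/
def ReducedAlgebra (H : HaarSystem X) (ω : TwoCocycle X) : Type _ :=
  (regularRange H ω).topologicalClosure

noncomputable instance (H : HaarSystem X) (ω : TwoCocycle X) :
    NonUnitalCStarAlgebra (ReducedAlgebra H ω) :=
  haveI : IsClosed ((regularRange H ω).topologicalClosure : Set (BoundedFamily H)) :=
    NonUnitalStarSubalgebra.isClosed_topologicalClosure _
  inferInstanceAs (NonUnitalCStarAlgebra (regularRange H ω).topologicalClosure)

/-- The inclusion of `C^*_r(Ξ, ω)` into the bounded families of operators. -/
def ReducedAlgebra.toFamily {H : HaarSystem X} {ω : TwoCocycle X} (a : ReducedAlgebra H ω) :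
    BoundedFamily H :=
  (show (regularRange H ω).topologicalClosure from a).1

/-- The canonical map `C_c(Ξ, ω) → C^*_r(Ξ, ω)`. -/
noncomputable def ReducedAlgebra.ofCc (H : HaarSystem X) (ω : TwoCocycle X) (f : C_c(Arr X, ℂ)) :
    ReducedAlgebra H ω :=
  (⟨regularFamily H ω f, NonUnitalStarSubalgebra.le_topologicalClosure _ ⟨f, rfl⟩⟩ :
    (regularRange H ω).topologicalClosure)

/-- The reduced norm on `C_c(Ξ, ω)`. -/
theorem ReducedAlgebra.norm_ofCc (H : HaarSystem X) (ω : TwoCocycle X) (f : C_c(Arr X, ℂ)) :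
    ‖ofCc H ω f‖ = ⨆ x, ‖regularRep H ω x f‖ :=
  BoundedFamily.norm_eq (regularFamily H ω f)

theorem ReducedAlgebra.denseRange_ofCc (H : HaarSystem X) (ω : TwoCocycle X) :
    DenseRange (ofCc H ω) := by
  intro a
  have ha : a.toFamily ∈ closure (Set.range (regularFamily H ω)) := a.2
  rw [Metric.mem_closure_range_iff] at ha ⊢
  exact ha

/-- The regular representation `Π_x` of `C^*_r(Ξ, ω)` on `ℋ_x = L²(Ξ_x; λ_x)`, the continuous
extension of `f ↦ Π_x(f)`. -/
noncomputable def reducedRep (H : HaarSystem X) (ω : TwoCocycle X) (x : X) :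
    ReducedAlgebra H ω →⋆ₙₐ[ℂ] (H.L2 x →L[ℂ] H.L2 x) where
  toFun a := a.toFamily.eval x
  map_smul' _ _ := rfl
  map_zero' := rfl
  map_add' _ _ := rfl
  map_mul' _ _ := rfl
  map_star' _ := rfl

theorem reducedRep_ofCc (H : HaarSystem X) (ω : TwoCocycle X) (x : X) (f : C_c(Arr X, ℂ)) :
    reducedRep H ω x (ReducedAlgebra.ofCc H ω f) = regularRep H ω x f := rfl

end Regular

end TwistedGroupoid

open TwistedGroupoid

/-!
The proof combines three facts about the regular representations `Π_x`.

* Equivalence along orbits. An arrow `γ : x ⟶ y` gives the twisted translation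
  `(Uu)(ηγ) = ω(η, γ) u(η)` from `L²(Ξ_y)` to `L²(Ξ_x)`. It preserves norms because the Haar system
  is right invariant, and it intertwines `Π_y` and `Π_x` by the cocycle identity
  (`convFibre_twist`). So `Π_x(a) = 0` forces `Π_y(a) = 0` on the whole orbit of `x`
  (`reducedRep_eq_zero_of_hom`).
* Continuity of matrix coefficients. For `u, v ∈ C_c(Ξ)` the function
  `y ↦ ⟨v|Ξ_y, Π_y(a) u|Ξ_y⟩` is continuous on the unit space (`continuous_inner_reducedRep`): for
  `a ∈ C_c(Ξ)` it is the fibre integral of an element of `C_c(Ξ)`, and a general `a` is a limit of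
  such elements, uniformly in `y`. If it vanishes on a dense orbit, it vanishes everywhere. As
  restrictions of `C_c(Ξ)` are dense in every `L²(Ξ_y)`, `Π_y(a) = 0` for all `y`, and then `a = 0`
  because the reduced norm is `sup_y ‖Π_y(a)‖` (`injective_reducedRep_of_dense_orbit`).
* Nondegeneracy (`isNondegenerate_reducedRep`). For `w ∈ L²(Ξ_x)` the convolution `g^⋆ ⋆ w` is a
  continuous function with value `⟨g, w⟩` at the unit `x`. If all `Π_x(f) w` vanish, `w` is thus
  orthogonal to all restrictions of `C_c(Ξ)`, so `w = 0`.

A nondegenerate representation `π` of any `C^*`-algebra `A` extends in exactly one way to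
multipliers, by `Φ(m) π(a) u = π(m a) u` (`IsNondegenerate.existsUnique_extension`), where `Φ(m)` is
obtained as a strong limit of `π(m e)` along an approximate unit. If `π` is injective, so is `Φ`:
from `Φ(m) = 0` it follows that `m a = 0` for all `a ∈ A` (`injective_extension`).
-/

/-! ### Extending representations to the multiplier algebra -/

section Multiplier

variable {A : Type*} [NonUnitalCStarAlgebra A]
  {𝓗 : Type*} [NormedAddCommGroup 𝓗] [InnerProductSpace ℂ 𝓗] [CompleteSpace 𝓗]

/-- A `*`-representation is nondegenerate if no nonzero vector is annihilated by all operators in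
its image. This is equivalent to the density of the span of the vectors `π a u`, see
`IsNondegenerate.dense_span`. -/
def IsNondegenerate (π : A →⋆ₙₐ[ℂ] (𝓗 →L[ℂ] 𝓗)) : Prop :=
  ∀ w : 𝓗, (∀ a, π a w = 0) → w = 0

theorem eq_of_forall_mul_left_eq {a b : A} (h : ∀ c, c * a = c * b) : a = b := by
  rw [← sub_eq_zero, ← CStarRing.star_mul_self_eq_zero_iff, mul_sub, h, sub_self]

theorem DoubleCentralizer.fst_mul (m : DoubleCentralizer ℂ A) (a b : A) :
    m.fst (a * b) = m.fst a * b := by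
  refine eq_of_forall_mul_left_eq fun c => ?_
  rw [← m.central, ← mul_assoc, m.central, mul_assoc]

theorem DoubleCentralizer.eq_zero_of_fst (m : DoubleCentralizer ℂ A)
    (h : ∀ a, m.fst a = 0) : m = 0 := by
  have hfst : m.fst = 0 := ContinuousLinearMap.ext h
  refine DoubleCentralizer.ext ℂ A _ _ (Prod.ext hfst (norm_eq_zero.1 ?_))
  rw [← DoubleCentralizer.norm_fst_eq_snd, hfst, norm_zero]

variable {π : A →⋆ₙₐ[ℂ] (𝓗 →L[ℂ] 𝓗)}

theorem inner_apply_left (π : A →⋆ₙₐ[ℂ] (𝓗 →L[ℂ] 𝓗)) (a : A) (u w : 𝓗) :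
    inner ℂ (π a u) w = inner ℂ u (π (star a) w) := by
  rw [map_star, ContinuousLinearMap.star_eq_adjoint, ContinuousLinearMap.adjoint_inner_right]

theorem IsNondegenerate.dense_span (hπ : IsNondegenerate π) :
    (Submodule.span ℂ {v | ∃ a u, v = π a u}).topologicalClosure = ⊤ := by
  rw [Submodule.topologicalClosure_eq_top_iff, eq_bot_iff]
  intro w hw
  rw [Submodule.mem_bot]
  refine hπ w fun a => ?_
  rw [← inner_self_eq_zero (𝕜 := ℂ), ← star_star a, ← inner_apply_left]
  exact (Submodule.mem_orthogonal _ _).1 hw _ (Submodule.subset_span ⟨_, _, rfl⟩)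

theorem IsNondegenerate.ext (hπ : IsNondegenerate π) {S T : 𝓗 →L[ℂ] 𝓗}
    (h : ∀ a u, S (π a u) = T (π a u)) : S = T := by
  refine ContinuousLinearMap.ext_on (s := {v | ∃ a u, v = π a u}) ?_ ?_
  · exact Submodule.dense_iff_topologicalClosure_eq_top.2 hπ.dense_span
  · rintro _ ⟨a, u, rfl⟩
    exact h a u

/-- The vectors along which an eventually bounded family of operators converges form a closed
set. -/
theorem isClosed_setOf_exists_tendsto {ι : Type*} {l : Filter ι} [l.NeBot] (F : ι → 𝓗 →L[ℂ] 𝓗)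
    {C : ℝ} (hF : ∀ᶠ i in l, ‖F i‖ ≤ C) :
    IsClosed {v | ∃ y, Tendsto (fun i => F i v) l (𝓝 y)} := by
  have hC : 0 ≤ C := by
    obtain ⟨i, hi⟩ := hF.exists
    exact (norm_nonneg _).trans hi
  refine isClosed_of_closure_subset fun v hv => ?_
  change ∃ y, _
  rw [← cauchy_map_iff_exists_tendsto, Metric.cauchy_iff]
  refine ⟨inferInstance, fun ε hε => ?_⟩
  obtain ⟨w, hw, hvw⟩ := Metric.mem_closure_iff.1 hv (ε / (3 * (C + 1))) (by positivity)
  have hw' : ∃ y, Tendsto (fun i => F i w) l (𝓝 y) := hw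
  rw [← cauchy_map_iff_exists_tendsto, Metric.cauchy_iff] at hw'
  obtain ⟨t, ht, htε⟩ := hw'.2 (ε / 3) (by positivity)
  have hclose (i : ι) (hi : ‖F i‖ ≤ C) : dist (F i v) (F i w) < ε / 3 := by
    rw [dist_eq_norm, ← map_sub]
    refine ((F i).le_of_opNorm_le hi _).trans_lt ?_
    rw [← dist_eq_norm]
    have h1 : (C + 1) * dist v w < ε / 3 := by
      rw [lt_div_iff₀ (by positivity)] at hvw
      linarith
    nlinarith [dist_nonneg (x := v) (y := w)]
  refine ⟨(fun i => F i v) '' {i | F i w ∈ t ∧ ‖F i‖ ≤ C},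
    image_mem_map (inter_mem ht hF), ?_⟩
  rintro _ ⟨i, ⟨hi, hi'⟩, rfl⟩ _ ⟨j, ⟨hj, hj'⟩, rfl⟩
  have h1 := hclose i hi'
  have h2 := hclose j hj'
  rw [dist_comm] at h2
  have h3 := htε _ hi _ hj
  have h4 := dist_triangle4 (F i v) (F i w) (F j w) (F j v)
  linarith

/-- The operator by which a multiplier `m` acts is the strong limit of `π (m e)` for `e` running
through an approximate unit: it exists on the vectors `π a u`, hence everywhere, as the operators
`π (m e)` are bounded by `‖m‖`. -/
theorem IsNondegenerate.exists_multiplier_apply (hπ : IsNondegenerate π)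
    (m : DoubleCentralizer ℂ A) :
    ∃ T : 𝓗 →L[ℂ] 𝓗, ∀ a u, T (π a u) = π (m.fst a) u := by
  let _ := CStarAlgebra.spectralOrder A
  have := CStarAlgebra.spectralOrderedRing A
  have hl := CStarAlgebra.increasingApproximateUnit A
  set l := CStarAlgebra.approximateUnit A
  have : l.NeBot := hl.neBot
  have hcont : Continuous π := map_continuous π
  have hlim (a : A) (u : 𝓗) : Tendsto (fun e => π (m.fst e) (π a u)) l (𝓝 (π (m.fst a) u)) := by
    have h1 : Tendsto (fun e => π (m.fst (e * a)) u) l (𝓝 (π (m.fst a) u)) :=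
      (((ContinuousLinearMap.apply ℂ 𝓗 u).continuous.comp
        (hcont.comp m.fst.continuous)).tendsto a).comp (hl.tendsto_mul_right a)
    refine h1.congr fun e => ?_
    rw [m.fst_mul, map_mul]
    rfl
  have hbound : ∀ᶠ e in l, ‖π (m.fst e)‖ ≤ ‖m.fst‖ := by
    filter_upwards [hl.eventually_norm] with e he
    exact (NonUnitalStarAlgHom.norm_apply_le π _).trans
      ((m.fst.le_of_opNorm_le_of_le le_rfl he).trans_eq (mul_one _))
  let S : Submodule ℂ 𝓗 :=
    { carrier := {v | ∃ y, Tendsto (fun e => π (m.fst e) v) l (𝓝 y)}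
      add_mem' := by
        rintro v w ⟨y, hy⟩ ⟨z, hz⟩
        exact ⟨y + z, by simpa using hy.add hz⟩
      zero_mem' := ⟨0, by simp⟩
      smul_mem' := by
        rintro c v ⟨y, hy⟩
        exact ⟨c • y, by simpa using hy.const_smul c⟩ }
  have hS : S = ⊤ := by
    rw [eq_top_iff, ← hπ.dense_span]
    refine Submodule.topologicalClosure_minimal _ (Submodule.span_le.2 ?_)
      (isClosed_setOf_exists_tendsto (fun e => π (m.fst e)) hbound)
    rintro _ ⟨a, u, rfl⟩
    exact ⟨_, hlim a u⟩
  have hex (v : 𝓗) : ∃ y, Tendsto (fun e => π (m.fst e) v) l (𝓝 y) := by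
    have : v ∈ S := hS ▸ Submodule.mem_top
    exact this
  choose T hT using hex
  let T' : 𝓗 →ₗ[ℂ] 𝓗 := linearMapOfTendsto T (fun e => (π (m.fst e) : 𝓗 →ₗ[ℂ] 𝓗))
    (tendsto_pi_nhds.2 hT)
  refine ⟨T'.mkContinuous ‖m.fst‖ fun v => ?_, fun a u => tendsto_nhds_unique (hT _) (hlim a u)⟩
  refine le_of_tendsto (hT v).norm ?_
  filter_upwards [hbound] with e he
  exact ContinuousLinearMap.le_of_opNorm_le _ he v

/-- The action of a multiplier on the space of a nondegenerate representation `π`: the operator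
determined by `π a u ↦ π (m a) u`. -/
noncomputable def IsNondegenerate.multiplierApply (hπ : IsNondegenerate π)
    (m : DoubleCentralizer ℂ A) : 𝓗 →L[ℂ] 𝓗 :=
  (hπ.exists_multiplier_apply m).choose

theorem IsNondegenerate.multiplierApply_apply (hπ : IsNondegenerate π)
    (m : DoubleCentralizer ℂ A) (a : A) (u : 𝓗) :
    hπ.multiplierApply m (π a u) = π (m.fst a) u :=
  (hπ.exists_multiplier_apply m).choose_spec a u

/-- The extension of a nondegenerate representation to the multiplier algebra. -/
noncomputable def IsNondegenerate.multiplierExtension (hπ : IsNondegenerate π) :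
    DoubleCentralizer ℂ A →⋆ₐ[ℂ] (𝓗 →L[ℂ] 𝓗) where
  toFun := hπ.multiplierApply
  map_one' := hπ.ext fun a u => by
    simp [hπ.multiplierApply_apply]
  map_mul' m n := hπ.ext fun a u => by
    simp [hπ.multiplierApply_apply]
  map_zero' := hπ.ext fun a u => by
    simp [hπ.multiplierApply_apply]
  map_add' m n := hπ.ext fun a u => by
    simp [hπ.multiplierApply_apply]
  commutes' c := hπ.ext fun a u => by
    simp [hπ.multiplierApply_apply, Algebra.algebraMap_eq_smul_one]
  map_star' m := hπ.ext fun a u => by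
    rw [ContinuousLinearMap.star_eq_adjoint, hπ.multiplierApply_apply, ← sub_eq_zero]
    refine hπ _ fun b => ext_inner_left ℂ fun w => ?_
    rw [← star_star b, ← inner_apply_left, inner_zero_right, inner_sub_right, sub_eq_zero,
      ContinuousLinearMap.adjoint_inner_right, hπ.multiplierApply_apply, inner_apply_left,
      inner_apply_left, ← mul_apply_eq_comp, ← mul_apply_eq_comp, ← map_mul, ← map_mul]
    congr 3
    simpa using congrArg star (m.central (star a) (star b))

theorem IsNondegenerate.multiplierExtension_coe (hπ : IsNondegenerate π) (a : A) :
    hπ.multiplierExtension (DoubleCentralizer.coe ℂ a) = π a :=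
  hπ.ext fun b u => by
    refine (hπ.multiplierApply_apply _ b u).trans ?_
    simp

/-- Any extension `Φ` of `π` satisfies `Φ(m) π(a) = π(m a)`, as `m a ∈ A`. -/
theorem extension_apply {Φ : DoubleCentralizer ℂ A →⋆ₐ[ℂ] (𝓗 →L[ℂ] 𝓗)}
    (hΦ : ∀ a, Φ (DoubleCentralizer.coe ℂ a) = π a) (m : DoubleCentralizer ℂ A) (a : A) :
    Φ m * π a = π (m.fst a) := by
  rw [← hΦ, ← hΦ, ← map_mul]
  congr 1
  refine DoubleCentralizer.ext ℂ A _ _ (Prod.ext ?_ ?_) <;> ext b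
  · exact m.fst_mul a b
  · exact m.central b a

theorem IsNondegenerate.existsUnique_extension (hπ : IsNondegenerate π) :
    ∃! Φ : DoubleCentralizer ℂ A →⋆ₐ[ℂ] (𝓗 →L[ℂ] 𝓗),
      ∀ a, Φ (DoubleCentralizer.coe ℂ a) = π a := by
  refine ⟨hπ.multiplierExtension, hπ.multiplierExtension_coe, fun Φ hΦ => ?_⟩
  refine StarAlgHom.ext fun m => hπ.ext fun a u => ?_
  rw [← mul_apply_eq_comp, ← mul_apply_eq_comp, extension_apply hΦ,
    extension_apply hπ.multiplierExtension_coe]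

/-- If `Φ(m) = 0`, then `π(m a) = 0` for all `a ∈ A`. -/
theorem injective_extension (hπ : Function.Injective π)
    {Φ : DoubleCentralizer ℂ A →⋆ₐ[ℂ] (𝓗 →L[ℂ] 𝓗)}
    (hΦ : ∀ a, Φ (DoubleCentralizer.coe ℂ a) = π a) : Function.Injective Φ := by
  rw [injective_iff_map_eq_zero]
  intro m hm
  refine m.eq_zero_of_fst fun a => hπ ?_
  rw [← extension_apply hΦ, hm, zero_mul, map_zero]

end Multiplier

namespace TwistedGroupoid

universe v u

/-! ### Restriction of compactly supported functions to the fibres -/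

/-- Tietze extension for compactly supported functions. -/
theorem exists_compactlySupported_extension {Y Z : Type*} [TopologicalSpace Y]
    [TopologicalSpace Z] [T2Space Z] [LocallyCompactSpace Z] [NormalSpace Z] {e : Y → Z}
    (he : IsClosedEmbedding e) {g : Y → ℂ} (hg : Continuous g) (hgs : HasCompactSupport g) :
    ∃ f : C_c(Z, ℂ), ∀ y, f (e y) = g y := by
  obtain ⟨G, hG⟩ := ContinuousMap.exists_extension he ⟨g, hg⟩
  have hG' (y : Y) : G (e y) = g y := DFunLike.congr_fun hG y
  obtain ⟨φ, hφ1, hφ2, -⟩ := exists_continuousMap_one_of_isCompact_subset_isOpen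
    (hgs.isCompact.image he.continuous) isOpen_univ (Set.subset_univ _)
  refine ⟨⟨⟨fun z => φ z * G z, by fun_prop⟩, ?_⟩, fun y => ?_⟩
  · exact HasCompactSupport.mul_right
      (HasCompactSupport.comp_left (g := fun z : ℝ => (z : ℂ)) hφ2 (by simp))
  · change (φ (e y) : ℂ) * G (e y) = g y
    rw [hG']
    by_cases hy : y ∈ tsupport g
    · rw [hφ1 ⟨y, hy, rfl⟩]
      simp
    · simp [image_eq_zero_of_notMem_tsupport hy]

section Restriction

variable {X : Type u} [Groupoid.{v} X] [TopologicalSpace X] [TopologicalSpace (Arr X)]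
  [TopGroupoid X] [T2Space (Arr X)]

theorem memLp_restrict (H : HaarSystem X) (u : C_c(Arr X, ℂ)) (x : X) :
    MemLp (fun η : Fibre x => u η.toArr) 2 (H.meas x) :=
  (u.continuous.comp (Fibre.continuous_toArr x)).memLp_of_hasCompactSupport
    (u.hasCompactSupport.comp_isClosedEmbedding (Fibre.isClosedEmbedding_toArr x))

/-- The restriction of `u ∈ C_c(Ξ)` to the fibre `Ξ_x`, as an element of `L²(Ξ_x; λ_x)`. -/
noncomputable def restrictLp (H : HaarSystem X) (u : C_c(Arr X, ℂ)) (x : X) : H.L2 x :=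
  (memLp_restrict H u x).toLp

theorem restrictLp_coeFn (H : HaarSystem X) (u : C_c(Arr X, ℂ)) (x : X) :
    restrictLp H u x =ᵐ[H.meas x] fun η => u η.toArr :=
  (memLp_restrict H u x).coeFn_toLp

variable [SigmaCompactSpace (Arr X)]

theorem exists_norm_restrictLp_le (H : HaarSystem X) (u : C_c(Arr X, ℂ)) :
    ∃ C : ℝ, ∀ x, ‖restrictLp H u x‖ ≤ C := by
  obtain ⟨C, hC⟩ := exists_fibre_bound H (u * u)
  refine ⟨C + 1, fun x => ?_⟩
  have h1 : eLpNorm (fun η : Fibre x => u η.toArr) 2 (H.meas x) ^ 2 ≤ C := by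
    rw [eLpNorm_two_sq]
    simpa [sq] using hC x
  have h2 : ‖restrictLp H u x‖ ^ 2 ≤ C := by
    rw [restrictLp, Lp.norm_toLp, ← ENNReal.toReal_pow]
    simpa using ENNReal.toReal_mono (by simp) h1
  nlinarith [C.2, sq_nonneg (‖restrictLp H u x‖ - 1)]

variable [LocallyCompactSpace (Arr X)]

theorem denseRange_restrictLp (H : HaarSystem X) (x : X) :
    DenseRange fun u => restrictLp H u x := by
  rw [DenseRange, EMetric.dense_iff]
  intro w ε hε
  obtain ⟨δ, hδ, hδε⟩ := exists_between hε
  obtain ⟨g, hgs, hgw, hgc, hgm⟩ :=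
    (Lp.memLp w).exists_hasCompactSupport_eLpNorm_sub_le (by simp) hδ.ne'
  obtain ⟨f, hf⟩ := exists_compactlySupported_extension (Fibre.isClosedEmbedding_toArr x) hgc hgs
  refine ⟨restrictLp H f x, ?_, f, rfl⟩
  have h1 : restrictLp H f x = hgm.toLp := MemLp.toLp_congr _ _ (.of_forall hf)
  rw [Metric.mem_eball, edist_comm, h1]
  nth_rw 1 [← Lp.toLp_coeFn w (Lp.memLp w)]
  rw [Lp.edist_toLp_toLp]
  exact hgw.trans_lt hδε

end Restriction

/-! ### Nondegeneracy of the regular representations -/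

section Nondegenerate

variable {X : Type u} [Groupoid.{v} X] [TopologicalSpace X] [TopologicalSpace (Arr X)]
  [TopGroupoid X] [T2Space (Arr X)]

/-- The unit `x`, seen as an element of its fibre `Ξ_x`. -/
def Fibre.unit (x : X) : Fibre x := ⟨x, 𝟙 x⟩

variable [LocallyCompactSpace (Arr X)]

/-- Smoothing: the convolution of `f ∈ C_c(Ξ)` with an `L²` function is continuous. -/
theorem continuous_convFibre (H : HaarSystem X) (ω : TwoCocycle X) (f : C_c(Arr X, ℂ)) {x : X}
    {w : Fibre x → ℂ} (hw : MemLp w 2 (H.meas x)) : Continuous (convFibre H ω f w) := by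
  rw [continuous_iff_continuousAt]
  intro ξ₀
  obtain ⟨N, hN, hNξ⟩ := exists_compact_mem_nhds ξ₀
  -- the `η ∈ Ξ_x` with `ξη⁻¹ ∈ supp f` for some `ξ ∈ N` form a compact set
  let K : Set (Fibre x) := Fibre.toArr ⁻¹' (Comp.mul ''
    ((fun p : Comp X => (p.fst, p.snd)) ⁻¹' ((Arr.inv '' tsupport f) ×ˢ (Fibre.toArr '' N))))
  have hK : IsCompact K :=
    (Fibre.isClosedEmbedding_toArr x).isCompact_preimage
      ((Comp.isClosedEmbedding_pair.isCompact_preimage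
        ((f.hasCompactSupport.isCompact.image TopGroupoid.continuous_inv).prod
          (hN.image (Fibre.continuous_toArr x)))).image TopGroupoid.continuous_mul)
  have hsupp (ξ η : Fibre x) (hξ : ξ ∈ N) (hη : η ∉ K) : convKernel ω f ξ η = 0 := by
    rw [convKernel, mul_eq_zero]
    left
    by_contra hne
    refine hη ⟨⟨x, ξ.tgt, η.tgt, Groupoid.inv ξ.hom ≫ η.hom, ξ.hom⟩,
      ⟨⟨_, subset_tsupport _ hne, ?_⟩, ⟨ξ, hξ, rfl⟩⟩, ?_⟩
    · simp [Arr.inv, Fibre.mulInv, Comp.fst]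
    · simp [Comp.mul, Fibre.toArr]
  have h := continuousOn_integral_bilinear_of_locally_integrable_of_compact_support
    (μ := H.meas x) (ContinuousLinearMap.mul ℂ ℂ) (f := convKernel ω f) (s := N) (g := w) hK
    (continuous_convKernel ω f x).continuousOn hsupp
    ((hw.locallyIntegrable (by norm_num)).integrableOn_isCompact hK)
  refine (h.continuousAt hNξ).congr (.of_forall fun ξ => ?_)
  rw [convFibre_eq]
  simp [mul_comm]

variable [SigmaCompactSpace (Arr X)]

/-- The kernel of `g^⋆` at a unit is the conjugate of `g`. -/
theorem convFibre_starCc_unit (H : HaarSystem X) (ω : TwoCocycle X) (g : C_c(Arr X, ℂ)) {x : X}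
    (w : H.L2 x) :
    convFibre H ω (starCc ω g) w (Fibre.unit x) = inner ℂ (restrictLp H g x) w := by
  rw [convFibre_eq, L2.inner_def]
  refine integral_congr_ae ?_
  filter_upwards [restrictLp_coeFn H g x] with η hη
  have h1 : η.mulInv (Fibre.unit x) = η.toArr := by
    simp [Fibre.mulInv, Fibre.unit, Fibre.toArr]
  have h2 : convKernel ω g η (Fibre.unit x) = g η.toArr := by
    have h3 : ω.app (Groupoid.inv (Fibre.unit x).hom ≫ η.hom) (Fibre.unit x).hom = 1 :=
      ω.unit_right _
    rw [convKernel, h1, h3, Circle.coe_one, mul_one]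
  rw [convKernel_starCc, h2, hη, RCLike.inner_apply, mul_comm]
  rfl

/-- If `w` is annihilated by all `Π_x(f)`, then the continuous function `g^⋆ ⋆ w` vanishes
identically for every `g ∈ C_c(Ξ)`. Its value at the unit is `⟨g, w⟩`. -/
theorem isNondegenerate_reducedRep (H : HaarSystem X) (ω : TwoCocycle X) (x : X) :
    IsNondegenerate (reducedRep H ω x) := by
  intro w hw
  refine (denseRange_restrictLp H x).eq_of_inner_right ℂ fun g => ?_
  have h1 : convFibre H ω (starCc ω g) w = 0 := by
    refine (Continuous.ae_eq_iff_eq (H.meas x)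
      (continuous_convFibre H ω (starCc ω g) (Lp.memLp w)) continuous_zero).1 ?_
    have h2 := regularRep_coeFn H ω x (starCc ω g) w
    rw [← reducedRep_ofCc, hw] at h2
    exact h2.symm.trans (Lp.coeFn_zero _ _ _)
  rw [← convFibre_starCc_unit H ω g w, h1, inner_zero_right]
  rfl

end Nondegenerate

/-! ### Unitary equivalence along an orbit -/

section Orbit

variable {X : Type u} [Groupoid.{v} X]

theorem orbit_eq_of_mem {x z : X} (h : x ∈ orbit z) : orbit x = orbit z := by
  obtain ⟨γ⟩ := h
  ext y
  exact ⟨fun ⟨δ⟩ => ⟨γ ≫ δ⟩, fun ⟨δ⟩ => ⟨Groupoid.inv γ ≫ δ⟩⟩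

variable [TopologicalSpace (Arr X)]

/-- The twisted translation `(Uu)(ηγ) = ω(η, γ) u(η)` along an arrow `γ : x ⟶ y`, taking functions
on `Ξ_y` to functions on `Ξ_x`. It is unitary for the `L²` norms and intertwines the regular
representations at `y` and `x`. -/
noncomputable def twist (ω : TwoCocycle X) {x y : X} (γ : x ⟶ y) (u : Fibre y → ℂ)
    (ζ : Fibre x) : ℂ :=
  (ω.app (Fibre.rightMul (Groupoid.inv γ) ζ).hom γ : ℂ) * u (Fibre.rightMul (Groupoid.inv γ) ζ)

theorem twist_rightMul (ω : TwoCocycle X) {x y : X} (γ : x ⟶ y) (u : Fibre y → ℂ) (η : Fibre y) :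
    twist ω γ u (Fibre.rightMul γ η) = (ω.app η.hom γ : ℂ) * u η := by
  have h : Fibre.rightMul (Groupoid.inv γ) (Fibre.rightMul γ η) = η := by
    simp [Fibre.rightMul]
  rw [twist, h]

theorem norm_twist (ω : TwoCocycle X) {x y : X} (γ : x ⟶ y) (u : Fibre y → ℂ) (ζ : Fibre x) :
    ‖twist ω γ u ζ‖ = ‖u (Fibre.rightMul (Groupoid.inv γ) ζ)‖ := by
  rw [twist, norm_mul, Circle.norm_coe, one_mul]

theorem convKernel_rightMul (ω : TwoCocycle X) (f : Arr X → ℂ) {x y : X} (γ : x ⟶ y)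
    (ξ η : Fibre y) :
    convKernel ω f (Fibre.rightMul γ ξ) (Fibre.rightMul γ η) * (ω.app η.hom γ : ℂ) =
      (ω.app ξ.hom γ : ℂ) * convKernel ω f ξ η := by
  have h1 : (Fibre.rightMul γ ξ).mulInv (Fibre.rightMul γ η) = ξ.mulInv η := by
    simp [Fibre.rightMul, Fibre.mulInv]
  have h2 : convKernel ω f (Fibre.rightMul γ ξ) (Fibre.rightMul γ η) =
      f ((Fibre.rightMul γ ξ).mulInv (Fibre.rightMul γ η)) *
        (ω.app (Groupoid.inv (γ ≫ η.hom) ≫ γ ≫ ξ.hom) (γ ≫ η.hom) : ℂ) := rfl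
  have h3 : Groupoid.inv (γ ≫ η.hom) ≫ γ ≫ ξ.hom = Groupoid.inv η.hom ≫ ξ.hom := by simp
  have h4 := ω.cocycle (Groupoid.inv η.hom ≫ ξ.hom) η.hom γ
  have h5 : η.hom ≫ Groupoid.inv η.hom ≫ ξ.hom = ξ.hom := by simp
  rw [h5] at h4
  have h6 := congrArg (fun z : Circle => (z : ℂ)) h4
  simp only [Circle.coe_mul] at h6
  rw [h2, h3, h1, convKernel]
  linear_combination (-f (ξ.mulInv η)) * h6

variable [TopologicalSpace X] [TopGroupoid X]

theorem measurePreserving_rightMul (H : HaarSystem X) {x y : X} (γ : x ⟶ y) :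
    MeasurePreserving (Fibre.rightMul γ) (H.meas y) (H.meas x) :=
  ⟨(Fibre.continuous_rightMul γ).measurable, H.map_rightMul γ⟩

theorem continuous_cocycle_right (ω : TwoCocycle X) {x y : X} (γ : x ⟶ y) :
    Continuous fun η : Fibre y => (ω.app η.hom γ : ℂ) := by
  have h : Continuous fun η : Fibre y => (⟨x, y, η.tgt, η.hom, γ⟩ : Comp X) := by
    rw [Comp.continuous_iff]
    exact ⟨Fibre.continuous_toArr y, continuous_const (y := (⟨x, y, γ⟩ : Arr X))⟩
  exact continuous_circle_coe.comp (ω.continuous_app.comp h)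

theorem aestronglyMeasurable_twist (H : HaarSystem X) (ω : TwoCocycle X) {x y : X} (γ : x ⟶ y)
    {u : Fibre y → ℂ} (hu : AEStronglyMeasurable u (H.meas y)) :
    AEStronglyMeasurable (twist ω γ u) (H.meas x) :=
  ((continuous_cocycle_right ω γ).stronglyMeasurable.aestronglyMeasurable.mul
    hu).comp_measurePreserving (measurePreserving_rightMul H (Groupoid.inv γ))

theorem eLpNorm_twist (H : HaarSystem X) (ω : TwoCocycle X) {x y : X} (γ : x ⟶ y)
    {u : Fibre y → ℂ} (hu : AEStronglyMeasurable u (H.meas y)) :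
    eLpNorm (twist ω γ u) 2 (H.meas x) = eLpNorm u 2 (H.meas y) := by
  rw [← eLpNorm_comp_measurePreserving hu (measurePreserving_rightMul H (Groupoid.inv γ))]
  exact eLpNorm_congr_norm_ae (.of_forall (norm_twist ω γ u))

variable [T2Space (Arr X)]

/-- The twisted translation intertwines convolution operators. -/
theorem convFibre_twist (H : HaarSystem X) (ω : TwoCocycle X) (f : Arr X → ℂ) {x y : X}
    (γ : x ⟶ y) (u : Fibre y → ℂ) :
    convFibre H ω f (twist ω γ u) = twist ω γ (convFibre H ω f u) := by
  ext ζ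
  obtain ⟨ξ, rfl⟩ := (Fibre.rightMulHomeo γ).surjective ζ
  change convFibre H ω f (twist ω γ u) (Fibre.rightMul γ ξ) =
    twist ω γ (convFibre H ω f u) (Fibre.rightMul γ ξ)
  rw [twist_rightMul, convFibre_eq, convFibre_eq, integral_rightMul H γ, ← integral_const_mul]
  congr 1
  ext η
  rw [twist_rightMul, ← mul_assoc, convKernel_rightMul, mul_assoc]

variable [LocallyCompactSpace (Arr X)] [SigmaCompactSpace (Arr X)]

theorem norm_regularRep_twist (H : HaarSystem X) (ω : TwoCocycle X) (f : C_c(Arr X, ℂ)) {x y : X}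
    (γ : x ⟶ y) (u : H.L2 y) (v : H.L2 x) (hv : v =ᵐ[H.meas x] twist ω γ u) :
    ‖regularRep H ω x f v‖ = ‖regularRep H ω y f u‖ := by
  have h1 : regularRep H ω x f v =ᵐ[H.meas x] twist ω γ (convFibre H ω f u) := by
    rw [← convFibre_twist]
    refine (regularRep_coeFn H ω x f v).trans (.of_forall fun ξ => ?_)
    rw [convFibre_eq, convFibre_eq]
    refine integral_congr_ae ?_
    filter_upwards [hv] with η hη
    rw [hη]
  have h2 := regularRep_coeFn H ω y f u
  have h3 : AEStronglyMeasurable (convFibre H ω f u) (H.meas y) :=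
    (Lp.aestronglyMeasurable _).congr h2
  rw [Lp.norm_def, Lp.norm_def, eLpNorm_congr_ae h1, eLpNorm_twist H ω γ h3, eLpNorm_congr_ae h2]

theorem continuous_reducedRep (H : HaarSystem X) (ω : TwoCocycle X) (x : X) :
    Continuous (reducedRep H ω x) :=
  AddMonoidHomClass.continuous_of_bound _ 1 fun a => by
    rw [one_mul]
    exact NonUnitalStarAlgHom.norm_apply_le _ a

/-- The regular representations at two units of the same orbit have the same kernel: by twisted
translation, `‖Π_x(b) Uu‖ = ‖Π_y(b) u‖` for `b ∈ C_c(Ξ)`, hence for all `b`. -/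
theorem reducedRep_eq_zero_of_hom (H : HaarSystem X) (ω : TwoCocycle X) {x y : X} (γ : x ⟶ y)
    {a : ReducedAlgebra H ω} (ha : reducedRep H ω x a = 0) : reducedRep H ω y a = 0 := by
  ext1 u
  have hm : MemLp (twist ω γ u) 2 (H.meas x) :=
    ⟨aestronglyMeasurable_twist H ω γ (Lp.aestronglyMeasurable u), by
      rw [eLpNorm_twist H ω γ (Lp.aestronglyMeasurable u)]
      exact (Lp.memLp u).2⟩
  have hx := continuous_reducedRep H ω x
  have hy := continuous_reducedRep H ω y
  have key : (fun b => ‖reducedRep H ω x b hm.toLp‖) = fun b => ‖reducedRep H ω y b u‖ := by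
    refine (ReducedAlgebra.denseRange_ofCc H ω).equalizer ?_ ?_ ?_
    · exact (hx.clm_apply continuous_const).norm
    · exact (hy.clm_apply continuous_const).norm
    · ext f
      exact norm_regularRep_twist H ω f γ u _ hm.coeFn_toLp
  have h := congrFun key a
  simp only [ha, zero_apply, norm_zero] at h
  exact norm_eq_zero.1 h.symm

end Orbit

/-! ### Continuity of matrix coefficients and faithfulness -/

section Faithful

variable {X : Type u} [Groupoid.{v} X] [TopologicalSpace X] [TopologicalSpace (Arr X)]
  [TopGroupoid X] [T2Space (Arr X)] [LocallyCompactSpace (Arr X)] [SigmaCompactSpace (Arr X)]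

/-- The matrix coefficient is the integral of `conj v · (f ⋆ u) ∈ C_c(Ξ)` along the fibres. -/
theorem continuous_inner_regularRep (H : HaarSystem X) (ω : TwoCocycle X) (f u v : C_c(Arr X, ℂ)) :
    Continuous fun y => inner ℂ (restrictLp H v y) (regularRep H ω y f (restrictLp H u y)) := by
  refine (H.continuous_integral (star v * convCc H ω f u)).congr fun y => ?_
  rw [L2.inner_def]
  refine integral_congr_ae ?_
  filter_upwards [restrictLp_coeFn H v y, regularRep_coeFn H ω y f (restrictLp H u y)] with ξ h1 h2
  have h3 : convFibre H ω f (restrictLp H u y) ξ = convCc H ω f u ξ.toArr := by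
    change _ = convFibre H ω f (fun η => u η.toArr) ξ
    rw [convFibre_eq, convFibre_eq]
    refine integral_congr_ae ?_
    filter_upwards [restrictLp_coeFn H u y] with η hη
    rw [hη]
  rw [h1, h2, h3, RCLike.inner_apply, mul_comm]
  rfl

theorem continuous_inner_reducedRep (H : HaarSystem X) (ω : TwoCocycle X) (a : ReducedAlgebra H ω)
    (u v : C_c(Arr X, ℂ)) :
    Continuous fun y => inner ℂ (restrictLp H v y) (reducedRep H ω y a (restrictLp H u y)) := by
  obtain ⟨Cu, hCu⟩ := exists_norm_restrictLp_le H u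
  obtain ⟨Cv, hCv⟩ := exists_norm_restrictLp_le H v
  refine continuous_of_uniform_approx_of_continuous fun s hs => ?_
  obtain ⟨ε, hε, hεs⟩ := Metric.mem_uniformity_dist.1 hs
  have hpos : 0 < |Cv| * |Cu| + 1 := by positivity
  obtain ⟨f, hf⟩ := Metric.mem_closure_range_iff.1 (ReducedAlgebra.denseRange_ofCc H ω a)
    (ε / (|Cv| * |Cu| + 1)) (by positivity)
  refine ⟨_, continuous_inner_regularRep H ω f u v, fun y => hεs ?_⟩
  rw [dist_eq_norm, ← inner_sub_right, ← reducedRep_ofCc, ← sub_apply, ← map_sub]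
  rw [dist_eq_norm, lt_div_iff₀ hpos] at hf
  set b := a - ReducedAlgebra.ofCc H ω f
  have hb : ‖reducedRep H ω y b‖ ≤ ‖b‖ := NonUnitalStarAlgHom.norm_apply_le _ b
  calc _ ≤ ‖restrictLp H v y‖ * (‖reducedRep H ω y b‖ * ‖restrictLp H u y‖) :=
        (norm_inner_le_norm _ _).trans (by gcongr; exact ContinuousLinearMap.le_opNorm _ _)
    _ ≤ |Cv| * (‖b‖ * |Cu|) := by
        gcongr
        · exact (hCv y).trans (le_abs_self _)
        · exact (hCu y).trans (le_abs_self _)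
    _ < ε := by nlinarith [norm_nonneg b]

/-- If `Π_x(a) = 0`, then `Π_y(a) = 0` for all `y` in the orbit of `x`. By density and continuity
the matrix coefficients of `a` vanish at all units. -/
theorem injective_reducedRep_of_dense_orbit (H : HaarSystem X) (ω : TwoCocycle X) {x : X}
    (hx : Dense (orbit x)) : Function.Injective (reducedRep H ω x) := by
  rw [injective_iff_map_eq_zero]
  intro a ha
  have hcoeff (u v : C_c(Arr X, ℂ)) :
      (fun y => inner ℂ (restrictLp H v y) (reducedRep H ω y a (restrictLp H u y))) = 0 := by
    refine (continuous_inner_reducedRep H ω a u v).ext_on hx continuous_zero ?_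
    rintro y ⟨γ⟩
    simp [reducedRep_eq_zero_of_hom H ω γ ha]
  have hzero (y : X) : reducedRep H ω y a = 0 := by
    refine ContinuousLinearMap.coeFn_injective ?_
    refine (denseRange_restrictLp H y).equalizer (map_continuous _) (map_continuous _) ?_
    ext1 u
    refine (denseRange_restrictLp H y).eq_of_inner_right ℂ fun v => ?_
    simpa using congrFun (hcoeff u v) y
  exact Subtype.ext (BoundedFamily.ext hzero)

end Faithful

end TwistedGroupoid

theorem proposition2p4 {X : Type*} [Groupoid X] [TopologicalSpace X]
    [TopologicalSpace (Arr X)] [TopGroupoid X] [T2Space (Arr X)] [LocallyCompactSpace (Arr X)]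
    [SigmaCompactSpace (Arr X)] (H : HaarSystem X) (ω : TwoCocycle X)
    (M : Set X) (hM : ∃ z : X, M = orbit z) (hdense : Dense M) (x : X) (hx : x ∈ M) :
    Function.Injective (reducedRep H ω x) ∧
    (∃! Φ : DoubleCentralizer ℂ (ReducedAlgebra H ω) →⋆ₐ[ℂ] (H.L2 x →L[ℂ] H.L2 x),
      ∀ a : ReducedAlgebra H ω, Φ (DoubleCentralizer.coe ℂ a) = reducedRep H ω x a) ∧
    ∀ Φ : DoubleCentralizer ℂ (ReducedAlgebra H ω) →⋆ₐ[ℂ] (H.L2 x →L[ℂ] H.L2 x),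
      (∀ a : ReducedAlgebra H ω, Φ (DoubleCentralizer.coe ℂ a) = reducedRep H ω x a) →
        Function.Injective Φ := by
  obtain ⟨z, rfl⟩ := hM
  rw [← orbit_eq_of_mem hx] at hdense
  have hinj := injective_reducedRep_of_dense_orbit H ω hdense
  exact ⟨hinj, (isNondegenerate_reducedRep H ω x).existsUnique_extension,
    fun Φ hΦ => injective_extension hinj hΦ⟩
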